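/- Let $G=(A\cup B,E)$ be a finite bipartite graph ($A$ the men, $B$ the women) in which every vertex has a strict preference order over its neighbours and prefers every neighbour to being unmatched, and let $C\subseteq A$ be a set of critical men. A matching of $G$ is feasible if it matches all men in $C$. For matchings $M,N$ let $\phi(M,N)$ be the number of vertices that prefer $M$ to $N$. A feasible matching $M$ is a popular feasible matching if $\phi(N,M)\le\phi(M,N)$ for every feasible matching $N$. It is a minimum size popular feasible matching if no popular feasible matching has fewer edges, and a dominant feasible matching if, in addition to being popular feasible, it satisfies $\phi(N,M)<\phi(M,N)$ for every feasible matching $N$ with $|N|>|M|$. (1) An edge $e\in E$ belongs to some popular feasible matching of $G$ if and only if it belongs to some minimum size popular feasible matching or to some dominant feasible matching of $G$. (2) There is an algorithm that, given $G$, $C$ and an edge $e\in E$, decides in time polynomial in $|A|+|B|+|E|$ whether $e$ belongs to some popular feasible matching of $G$. (If $G$ has no feasible matching, then no edge belongs to a matching of any of these kinds, and the algorithm answers no.) -/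

import Mathlib

/-- A marriage instance on the men `A` and the women `B`. Every vertex has a preference list: a
repetition-free list of its neighbours, most preferred first. The edges of the bipartite graph are
the pairs `(a, b)` with `b` on the list of `a`, equivalently `a` on the list of `b`. -/
structure MarriageInstance (A B : Type*) where
  menPref : A → List B
  womenPref : B → List A
  menPref_nodup : ∀ a, (menPref a).Nodup
  womenPref_nodup : ∀ b, (womenPref b).Nodup
  mem_menPref_iff : ∀ a b, b ∈ menPref a ↔ a ∈ womenPref b

namespace MarriageInstance

section Matchings

variable {A B : Type*} (I : MarriageInstance A B)

/-- `e` is an edge of the graph. -/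
def IsEdge (e : A × B) : Prop := e.2 ∈ I.menPref e.1

/-- `M` is a matching: a set of edges no two of which share an endpoint. -/
def IsMatching (M : Finset (A × B)) : Prop :=
  (∀ e ∈ M, I.IsEdge e) ∧
  (∀ e ∈ M, ∀ f ∈ M, e.1 = f.1 → e = f) ∧
  (∀ e ∈ M, ∀ f ∈ M, e.2 = f.2 → e = f)

/-- `M` is a feasible matching for the set `C` of critical men: it matches all of them. -/
def IsFeasible (C : Set A) (M : Finset (A × B)) : Prop :=
  I.IsMatching M ∧ ∀ a ∈ C, ∃ b, (a, b) ∈ M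

variable [DecidableEq A] [DecidableEq B]

/-- The man `a` prefers the matching `M` to the matching `N`: he is matched in `M`, and he is
either unmatched in `N` or has a partner in `N` that comes later on his list. -/
def ManPrefers (a : A) (M N : Finset (A × B)) : Prop :=
  ∃ b, (a, b) ∈ M ∧ ∀ b', (a, b') ∈ N → (I.menPref a).idxOf b < (I.menPref a).idxOf b'

/-- The woman `b` prefers the matching `M` to the matching `N`. -/
def WomanPrefers (b : B) (M N : Finset (A × B)) : Prop :=
  ∃ a, (a, b) ∈ M ∧ ∀ a', (a', b) ∈ N → (I.womenPref b).idxOf a < (I.womenPref b).idxOf a'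

variable [Fintype A] [Fintype B]

open Classical in
/-- The number of vertices that prefer `M` to `N`. -/
noncomputable def votes (M N : Finset (A × B)) : ℕ :=
  (Finset.univ.filter fun a : A => I.ManPrefers a M N).card +
    (Finset.univ.filter fun b : B => I.WomanPrefers b M N).card

/-- `M` is a popular feasible matching: it is feasible and loses to no feasible matching. -/
def IsPopularFeasible (C : Set A) (M : Finset (A × B)) : Prop :=
  I.IsFeasible C M ∧ ∀ N, I.IsFeasible C N → I.votes N M ≤ I.votes M N

/-- `M` is a minimum size popular feasible matching. -/
def IsMinSizePopularFeasible (C : Set A) (M : Finset (A × B)) : Prop :=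
  I.IsPopularFeasible C M ∧ ∀ N, I.IsPopularFeasible C N → M.card ≤ N.card

/-- `M` is a dominant feasible matching: it is a popular feasible matching that gets strictly more
votes than every larger feasible matching. -/
def IsDominantFeasible (C : Set A) (M : Finset (A × B)) : Prop :=
  I.IsPopularFeasible C M ∧ ∀ N, I.IsFeasible C N → M.card < N.card → I.votes N M < I.votes M N

end Matchings

end MarriageInstance

/-! ### A machine model with a step count

A small structured programming language on binary trees, in the style of the WHILE language of
N. D. Jones. Every execution step is charged the size of the data that it acts on, so the running
time is polynomially related to that of Turing machines. -/

/-- The data: binary trees with unlabelled nodes. -/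
abbrev Data := BinaryTree Unit

/-- The size of a tree: the number of its leaves (one more than the number of its nodes). -/
def Data.size (x : Data) : ℕ := x.numNodes + 1

/-- Programs. Each denotes a partial function from trees to trees. A tree other than `nil` counts
as true. -/
inductive Code
  /-- the input itself -/
  | id
  /-- the constant `nil` -/
  | nil
  /-- the left subtree (`nil` for `nil`) -/
  | fst
  /-- the right subtree (`nil` for `nil`) -/
  | snd
  /-- are the left and the right subtree equal? -/
  | eq
  /-- the tree with left subtree `f x` and right subtree `g x` -/
  | pair (f g : Code)
  /-- first `f`, then `g` -/
  | seq (f g : Code)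
  /-- if `c x` is true then `f x` else `g x` -/
  | ite (c f g : Code)
  /-- while `c x` is true replace `x` by `f x` -/
  | loop (c f : Code)

/-- `Code.Runs p x y t`: on the input `x` the program `p` halts with the output `y` after time
`t`. -/
inductive Code.Runs : Code → Data → Data → ℕ → Prop
  | id (x : Data) : Runs .id x x x.size
  | nil (x : Data) : Runs .nil x .nil x.size
  | fst_nil : Runs .fst .nil .nil (Data.size .nil)
  | fst_node (y z : Data) : Runs .fst (.node () y z) y (Data.size (.node () y z))
  | snd_nil : Runs .snd .nil .nil (Data.size .nil)
  | snd_node (y z : Data) : Runs .snd (.node () y z) z (Data.size (.node () y z))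
  | eq_nil : Runs .eq .nil .nil (Data.size .nil)
  | eq_same (y : Data) :
      Runs .eq (.node () y y) (.node () .nil .nil) (Data.size (.node () y y))
  | eq_diff (y z : Data) (h : y ≠ z) : Runs .eq (.node () y z) .nil (Data.size (.node () y z))
  | pair {f g : Code} {x y z : Data} {s t : ℕ} (hf : Runs f x y s) (hg : Runs g x z t) :
      Runs (.pair f g) x (.node () y z) (s + t + x.size)
  | seq {f g : Code} {x y z : Data} {s t : ℕ} (hf : Runs f x y s) (hg : Runs g y z t) :
      Runs (.seq f g) x z (s + t + x.size)
  | ite_true {c f g : Code} {x b y : Data} {s t : ℕ} (hc : Runs c x b s) (hb : b ≠ .nil)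
      (hf : Runs f x y t) : Runs (.ite c f g) x y (s + t + x.size)
  | ite_false {c f g : Code} {x y : Data} {s t : ℕ} (hc : Runs c x .nil s)
      (hg : Runs g x y t) : Runs (.ite c f g) x y (s + t + x.size)
  | loop_stop {c f : Code} {x : Data} {s : ℕ} (hc : Runs c x .nil s) :
      Runs (.loop c f) x x (s + x.size)
  | loop_step {c f : Code} {x b y z : Data} {s t u : ℕ} (hc : Runs c x b s) (hb : b ≠ .nil)
      (hf : Runs f x y t) (hl : Runs (.loop c f) y z u) :
      Runs (.loop c f) x z (s + t + u + x.size)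

/-- Programs are deterministic: the input determines the output and the running time. -/
theorem Code.Runs.deterministic {p : Code} {x y z : Data} {s t : ℕ}
    (h : p.Runs x y s) (h' : p.Runs x z t) : y = z ∧ s = t := by
  induction h generalizing z t with
  | id | nil | fst_nil | fst_node | snd_nil | snd_node | eq_nil => cases h'; exact ⟨rfl, rfl⟩
  | eq_same y =>
    cases h' with
    | eq_same => exact ⟨rfl, rfl⟩
    | eq_diff _ _ h => exact absurd rfl h
  | eq_diff y z h =>
    cases h' with
    | eq_same => exact absurd rfl h
    | eq_diff => exact ⟨rfl, rfl⟩
  | pair _ _ ihf ihg =>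
    cases h' with
    | pair hf hg =>
      obtain ⟨rfl, rfl⟩ := ihf hf
      obtain ⟨rfl, rfl⟩ := ihg hg
      exact ⟨rfl, rfl⟩
  | seq _ _ ihf ihg =>
    cases h' with
    | seq hf hg =>
      obtain ⟨rfl, rfl⟩ := ihf hf
      obtain ⟨rfl, rfl⟩ := ihg hg
      exact ⟨rfl, rfl⟩
  | ite_true _ hb _ ihc ihf =>
    cases h' with
    | ite_true hc _ hf =>
      obtain ⟨rfl, rfl⟩ := ihc hc
      obtain ⟨rfl, rfl⟩ := ihf hf
      exact ⟨rfl, rfl⟩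
    | ite_false hc _ => exact absurd (ihc hc).1 hb
  | ite_false _ _ ihc ihg =>
    cases h' with
    | ite_true hc hb _ => exact absurd (ihc hc).1.symm hb
    | ite_false hc hg =>
      obtain ⟨-, rfl⟩ := ihc hc
      obtain ⟨rfl, rfl⟩ := ihg hg
      exact ⟨rfl, rfl⟩
  | loop_stop _ ihc =>
    cases h' with
    | loop_stop hc =>
      obtain ⟨-, rfl⟩ := ihc hc
      exact ⟨rfl, rfl⟩
    | loop_step hc hb _ _ => exact absurd (ihc hc).1.symm hb
  | loop_step _ hb _ _ ihc ihf ihl =>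
    cases h' with
    | loop_stop hc => exact absurd (ihc hc).1 hb
    | loop_step hc _ hf hl =>
      obtain ⟨rfl, rfl⟩ := ihc hc
      obtain ⟨rfl, rfl⟩ := ihf hf
      obtain ⟨rfl, rfl⟩ := ihl hl
      exact ⟨rfl, rfl⟩

/-! ### Encoding of the inputs -/

/-- A truth value as a tree. -/
def Data.ofBool : Bool → Data
  | false => .nil
  | true => .node () .nil .nil

/-- A list of trees as a tree. -/
def Data.ofList : List Data → Data
  | [] => .nil
  | x :: l => .node () x (Data.ofList l)

/-- A vertex name as a tree, in unary. -/
def Data.ofNat (k : ℕ) : Data := Data.ofList (List.replicate k .nil)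

namespace MarriageInstance

variable {n m : ℕ} (I : MarriageInstance (Fin n) (Fin m))

/-- The size of an instance: the number of vertices plus the number of edges. -/
def size : ℕ := n + m + ∑ a, (I.menPref a).length

/-- The input of the popular feasible edge problem as a tree: the edge; the list of the men, each
with his name, a bit that says whether he is critical, and his preference list; the list of the
women, each with her name and her preference list. -/
def encode (C : Finset (Fin n)) (e : Fin n × Fin m) : Data :=
  .node () (.node () (Data.ofNat e.1) (Data.ofNat e.2))
    (.node ()
      (Data.ofList ((List.finRange n).map fun a : Fin n =>
        .node () (Data.ofNat a) (.node () (Data.ofBool (decide (a ∈ C)))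
          (Data.ofList ((I.menPref a).map fun b => Data.ofNat b)))))
      (Data.ofList ((List.finRange m).map fun b : Fin m =>
        .node () (Data.ofNat b) (Data.ofList ((I.womenPref b).map fun a => Data.ofNat a)))))

end MarriageInstance

/-- The program `p` solves the popular feasible edge problem within the time bound `T`, a function
of the number of vertices plus the number of edges: given any marriage instance, any set of
critical men and any edge, it halts in time and its output is true exactly if some popular
feasible matching contains the edge. -/
def Code.SolvesPopularFeasibleEdge (p : Code) (T : ℕ → ℕ) : Prop :=
  ∀ (n m : ℕ) (I : MarriageInstance (Fin n) (Fin m)) (C : Finset (Fin n)) (e : Fin n × Fin m),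
    I.IsEdge e →
      ∃ (y : Data) (t : ℕ), p.Runs (I.encode C e) y t ∧ t ≤ T I.size ∧
        (y ≠ .nil ↔ ∃ M, I.IsPopularFeasible (C : Set (Fin n)) M ∧ e ∈ M)

set_option linter.unusedSectionVars false

/-! Popularity of `M` among the feasible matchings is optimality in an assignment problem. An edge
weighs the votes of its endpoints against their partners in `M`, an unmatched vertex weighs its own
vote, and a critical man may not stay unmatched. Duality with integer potentials yields a
certificate `(y, z)` (`IsPopularFeasible.exists_isWitness`), and a certificate proves popularity by
weak duality. Complementary slackness gives more. If all `y a` are even, a feasible matching that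
does not lose to `M` matches every man matched by `M`, so `M` has minimum size. If `y` is odd on all
men matched by `M`, such a matching matches only men matched by `M`, so `M` is dominant.

Certificates of one parity `c ∈ {0, 1}` come from stable matchings. In the multigraph `levelEdges C
c K` men prefer low levels and women high ones, and a stable matching gives the certificate with `y
a = c - 2 * i` for a man matched at level `i` (`IsLevelStable.exists_isWitness`). The certificate of
an arbitrary popular matching may mix parities. Rounding it to the parity `c` sets a minimum
standard for every vertex. A stable matching of the edges that meet all standards is stable in the
whole multigraph and contains every edge of `M` whose potential has the parity `c`
(`IsWitness.isLevelStable`). So each single edge of `M`, though perhaps not `M` itself, lies in a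
matching of one of the two kinds.

For the algorithm, an edge lies in some stable matching if and only if Gale-Shapley finds it after
the edges that its woman likes less are deleted (`IsStableIn.mem_galeShapleyMatching`,
`isStableIn_of_mem_galeShapleyMatching`). With enough levels every stable matching is feasible
unless no matching is (`IsLevelStable.isFeasible`). The time bound follows from closure properties
of `PolyTime`, above all `PolyTime.foldl`. -/

/-! ### Integral duality for the assignment problem -/

open Finset in
/-- Egerváry's theorem: an optimal assignment has a tight dual solution. -/
theorem exists_dual_of_optimal_assignment {L R : Type*} [Fintype L] [Fintype R]
    (w : L → R → ℤ) (τ : L ≃ R)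
    (h : ∀ σ : L ≃ R, ∑ l, w l (σ l) ≤ ∑ l, w l (τ l)) :
    ∃ (y : L → ℤ) (z : R → ℤ), (∀ l r, w l r ≤ y l + z r) ∧
      ∀ l, y l + z (τ l) = w l (τ l) := by
  classical
  have sum_dual (σ : L ≃ R) (y : L → ℤ) (z : R → ℤ) :
      ∑ l, (y l + z (σ l)) = ∑ l, y l + ∑ r, z r := by
    rw [sum_add_distrib, Equiv.sum_comp σ z]
  -- The excess of a dual solution over the value of `τ` is a natural number, so some solution has
  -- least excess.
  have hex : ∃ n : ℕ, ∃ (y : L → ℤ) (z : R → ℤ), (∀ l r, w l r ≤ y l + z r) ∧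
      ∑ l, y l + ∑ r, z r = ∑ l, w l (τ l) + n := by
    let y : L → ℤ := fun l => ∑ r, |w l r|
    have hy : ∀ l r, w l r ≤ y l := fun l r =>
      (le_abs_self _).trans (single_le_sum (f := fun r => |w l r|) (fun _ _ => abs_nonneg _)
        (mem_univ r))
    refine ⟨(∑ l, y l - ∑ l, w l (τ l)).toNat, y, 0, fun l r => by simpa using hy l r, ?_⟩
    have : ∑ l, w l (τ l) ≤ ∑ l, y l := sum_le_sum fun l _ => hy l _
    rw [Int.toNat_of_nonneg (by lia)]
    simp
  obtain ⟨y, z, hyz, hn⟩ := Nat.find_spec hex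
  have hmin := fun m (hm : m < Nat.find hex) => Nat.find_min hex hm
  generalize Nat.find hex = n at hn hmin
  refine ⟨y, z, hyz, ?_⟩
  let t : L → Finset R := fun l => univ.filter fun r => y l + z r = w l r
  -- Hall's condition for the graph of tight pairs. If it holds, a perfect matching of tight pairs
  -- attains the dual value, so `τ` attains it as well and has no slack.
  by_cases hall : ∀ s : Finset L, #s ≤ #(s.biUnion t)
  · obtain ⟨f, hf, hft⟩ := (all_card_le_biUnion_card_iff_exists_injective t).1 hall
    have hbij : Function.Bijective f :=
      (Fintype.bijective_iff_injective_and_card f).2 ⟨hf, Fintype.card_congr τ⟩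
    have h1 := h (Equiv.ofBijective f hbij)
    have h2 : ∑ l, w l (f l) = ∑ l, y l + ∑ r, z r := by
      rw [← sum_dual (Equiv.ofBijective f hbij)]
      refine sum_congr rfl fun l _ => ?_
      have := hft l
      simp only [t, mem_filter, mem_univ, true_and] at this
      simpa using this.symm
    have h3 : ∑ l, (y l + z (τ l) - w l (τ l)) ≤ 0 := by
      rw [sum_sub_distrib, sum_dual, ← h2]
      simpa using h1
    have h4 := (sum_eq_zero_iff_of_nonneg (fun l _ => sub_nonneg.2 (hyz l (τ l)))).1
      (le_antisymm h3 (sum_nonneg fun l _ => sub_nonneg.2 (hyz l (τ l))))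
    exact fun l => by linarith [h4 l (mem_univ l)]
  · push Not at hall
    obtain ⟨s, hs⟩ := hall
    -- At a violator `s` of Hall's condition, lower `y` on `s` and raise `z` on its tight
    -- neighbours. By integrality a pair that is not tight has slack at least 1, so the solution
    -- stays feasible while the excess drops.
    let y' : L → ℤ := fun l => y l - if l ∈ s then 1 else 0
    let z' : R → ℤ := fun r => z r + if r ∈ s.biUnion t then 1 else 0
    have hyz' : ∀ l r, w l r ≤ y' l + z' r := by
      intro l r
      have h1 := hyz l r
      by_cases hl : l ∈ s
      · by_cases hr : r ∈ s.biUnion t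
        · simp only [y', z', hl, hr, if_true]; lia
        · have : y l + z r ≠ w l r := fun h0 => hr (mem_biUnion.2 ⟨l, hl, by simp [t, h0]⟩)
          simp only [y', z', hl, hr, if_true, if_false]; lia
      · simp only [y', z', hl, if_false]; split_ifs <;> lia
    have hsum : ∑ l, y' l + ∑ r, z' r = ∑ l, w l (τ l) + n - #s + #(s.biUnion t) := by
      simp only [y', z', sum_sub_distrib, sum_add_distrib, ← hn, sum_boole, filter_univ_mem]
      ring
    have hge : ∑ l, w l (τ l) ≤ ∑ l, y' l + ∑ r, z' r := by
      rw [← sum_dual τ]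
      exact sum_le_sum fun l _ => hyz' _ _
    refine absurd ⟨y', z', hyz', ?_⟩ (hmin (n + #(s.biUnion t) - #s) (by lia))
    rw [hsum]
    lia

/-! ### Votes of a single vertex -/

section Votes

variable {X : Type*} (rank : X → ℕ)

open Classical in
/-- The vote of a vertex for the neighbour `x` against its partner, the element of `P` if there is
one. -/
noncomputable def vote (P : X → Prop) (x : X) : ℤ :=
  if P x then 0 else if ∃ x', P x' ∧ rank x' < rank x then -1 else 1

open Classical in
/-- The vote of a vertex for its partner in `Q` against its partner in `P`. -/
noncomputable def netVote (Q P : X → Prop) : ℤ :=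
  (if ∃ x, Q x ∧ ∀ x', P x' → rank x < rank x' then 1 else 0) -
    (if ∃ x, P x ∧ ∀ x', Q x' → rank x < rank x' then 1 else 0)

variable {rank} {P Q : X → Prop} {x x' : X}

theorem vote_self (h : P x) : vote rank P x = 0 := if_pos h

theorem vote_of_free (h : ∀ x, ¬ P x) : vote rank P x = 1 := by
  rw [vote, if_neg (h x), if_neg fun ⟨x', hx', _⟩ => h x' hx']

theorem vote_of_lt (hP : ∀ x, P x → x = x') (h : rank x < rank x') :
    vote rank P x = 1 := by
  rw [vote, if_neg fun hx => h.ne (congrArg rank (hP x hx)), if_neg]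
  rintro ⟨u, hu, hlt⟩
  rw [hP u hu] at hlt
  lia

theorem vote_of_gt (hP : ∀ x, P x → x = x') (h' : P x') (h : rank x' < rank x) :
    vote rank P x = -1 := by
  rw [vote, if_neg fun hx => h.ne' (congrArg rank (hP x hx)), if_pos ⟨x', h', h⟩]

theorem vote_le_one : vote rank P x ≤ 1 := by
  unfold vote; split_ifs <;> simp

theorem vote_of_not (h : ¬ P x) : vote rank P x = -1 ∨ vote rank P x = 1 := by
  unfold vote; split_ifs <;> simp

theorem vote_cases : vote rank P x = 0 ∨ vote rank P x = -1 ∨ vote rank P x = 1 := by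
  unfold vote; split_ifs <;> simp

theorem netVote_eq_vote (hQ : ∀ u, Q u → u = x) (hx : Q x) (hP : ∀ u v, P u → P v → u = v)
    (hr : ∀ u, P u → rank u = rank x → u = x) : netVote rank Q P = vote rank P x := by
  have e1 : (∃ u, Q u ∧ ∀ x', P x' → rank u < rank x') ↔ ∀ x', P x' → rank x < rank x' :=
    ⟨fun ⟨u, hu, h⟩ => by rwa [hQ u hu] at h, fun h => ⟨x, hx, h⟩⟩
  have e2 : (∃ u, P u ∧ ∀ x', Q x' → rank u < rank x') ↔ ∃ u, P u ∧ rank u < rank x :=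
    ⟨fun ⟨u, hu, h⟩ => ⟨u, hu, h x hx⟩, fun ⟨u, hu, h⟩ => ⟨u, hu, fun v hv => by rwa [hQ v hv]⟩⟩
  classical
  unfold netVote vote
  simp only [e1, e2]
  by_cases hp : ∃ u, P u
  · obtain ⟨u, hu⟩ := hp
    have e3 : (∀ x', P x' → rank x < rank x') ↔ rank x < rank u :=
      ⟨fun h => h u hu, fun h v hv => by rwa [hP v u hv hu]⟩
    have e4 : (∃ x', P x' ∧ rank x' < rank x) ↔ rank u < rank x :=
      ⟨fun ⟨v, hv, h⟩ => by rwa [hP u v hu hv], fun h => ⟨u, hu, h⟩⟩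
    have e5 : P x ↔ rank u = rank x :=
      ⟨fun h => by rw [hP u x hu h], fun h => hr u hu h ▸ hu⟩
    simp only [e3, e4, e5]
    split_ifs <;> first | rfl | lia
  · push Not at hp
    simp [hp]

theorem netVote_of_free (hQ : ∀ x, ¬ Q x) (h : P x') : netVote rank Q P = -1 := by
  unfold netVote
  rw [if_neg fun ⟨u, hu, _⟩ => hQ u hu, if_pos ⟨x', h, fun u hu => absurd hu (hQ u)⟩]
  rfl

theorem netVote_of_free_of_free (hQ : ∀ x, ¬ Q x) (hP : ∀ x, ¬ P x) :
    netVote rank Q P = 0 := by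
  simp [netVote, hQ, hP]

end Votes

namespace MarriageInstance

variable {A B : Type*} (I : MarriageInstance A B)

section Rank

/-- The position of the woman `b` on the list of the man `a`. -/
def manRank [DecidableEq B] (a : A) (b : B) : ℕ := (I.menPref a).idxOf b

/-- The position of the man `a` on the list of the woman `b`. -/
def womanRank [DecidableEq A] (b : B) (a : A) : ℕ := (I.womenPref b).idxOf a

theorem manRank_inj [DecidableEq B] {a : A} {b b' : B} (h : I.IsEdge (a, b)) :
    I.manRank a b = I.manRank a b' ↔ b = b' := List.idxOf_inj h

theorem womanRank_inj [DecidableEq A] {a a' : A} {b : B} (h : I.IsEdge (a, b)) :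
    I.womanRank b a = I.womanRank b a' ↔ a = a' :=
  List.idxOf_inj ((I.mem_menPref_iff _ _).1 h)

variable [DecidableEq A] [DecidableEq B]

/-- The vote of the man `a` for the woman `b` against his partner in `M`. -/
noncomputable def manVote (M : Finset (A × B)) (a : A) (b : B) : ℤ :=
  vote (I.manRank a) (fun b => (a, b) ∈ M) b

/-- The vote of the woman `b` for the man `a` against her partner in `M`. -/
noncomputable def womanVote (M : Finset (A × B)) (b : B) (a : A) : ℤ :=
  vote (I.womanRank b) (fun a => (a, b) ∈ M) a

/-- The vote of the man `a` for `N` against `M`. -/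
noncomputable def manNet (N M : Finset (A × B)) (a : A) : ℤ :=
  netVote (I.manRank a) (fun b => (a, b) ∈ N) (fun b => (a, b) ∈ M)

/-- The vote of the woman `b` for `N` against `M`. -/
noncomputable def womanNet (N M : Finset (A × B)) (b : B) : ℤ :=
  netVote (I.womanRank b) (fun a => (a, b) ∈ N) (fun a => (a, b) ∈ M)

theorem votes_sub_votes [Fintype A] [Fintype B] (N M : Finset (A × B)) :
    (I.votes N M : ℤ) - I.votes M N = ∑ a, I.manNet N M a + ∑ b, I.womanNet N M b := by
  classical
  have h1 (a : A) : I.manNet N M a = (if I.ManPrefers a N M then 1 else 0) -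
      (if I.ManPrefers a M N then 1 else 0) := by
    unfold manNet netVote ManPrefers manRank; congr
  have h2 (b : B) : I.womanNet N M b = (if I.WomanPrefers b N M then 1 else 0) -
      (if I.WomanPrefers b M N then 1 else 0) := by
    unfold womanNet netVote WomanPrefers womanRank; congr
  have h3 (N M : Finset (A × B)) : (I.votes N M : ℤ) =
      ∑ a, (if I.ManPrefers a N M then 1 else 0) + ∑ b, if I.WomanPrefers b N M then 1 else 0 := by
    rw [votes, Nat.cast_add, Finset.sum_boole, Finset.sum_boole]

  simp only [h1, h2, h3, Finset.sum_sub_distrib]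
  ring

end Rank

variable {I}

theorem IsMatching.right_unique {M : Finset (A × B)} (hM : I.IsMatching M) {a : A} {b b' : B}
    (h : (a, b) ∈ M) (h' : (a, b') ∈ M) : b = b' :=
  congrArg Prod.snd (hM.2.1 _ h _ h' rfl)

theorem IsMatching.left_unique {M : Finset (A × B)} (hM : I.IsMatching M) {a a' : A} {b : B}
    (h : (a, b) ∈ M) (h' : (a', b) ∈ M) : a = a' :=
  congrArg Prod.fst (hM.2.2 _ h _ h' rfl)

theorem IsMatching.card_le_card {M N : Finset (A × B)} (hM : I.IsMatching M)
    (h : ∀ a, (∃ b, (a, b) ∈ M) → ∃ b, (a, b) ∈ N) : M.card ≤ N.card := by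
  classical
  rw [← Finset.card_image_of_injOn (s := M) (f := Prod.fst) fun e he f hf h => hM.2.1 e he f hf h]
  refine (Finset.card_le_card (t := N.image Prod.fst) fun a ha => ?_).trans Finset.card_image_le
  obtain ⟨b, hb⟩ := h a (by simpa using ha)
  exact Finset.mem_image.2 ⟨_, hb, rfl⟩

/-! ### Dual certificates and what they imply -/

section Net

variable [DecidableEq A] [DecidableEq B] {M N : Finset (A × B)}

theorem manNet_of_mem (hN : I.IsMatching N) (hM : I.IsMatching M) {a : A} {b : B}
    (h : (a, b) ∈ N) : I.manNet N M a = I.manVote M a b :=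
  netVote_eq_vote (fun _ hu => hN.right_unique hu h) h (fun _ _ hu hv => hM.right_unique hu hv)
    fun _ hu hr => (I.manRank_inj (hM.1 _ hu)).1 hr

theorem womanNet_of_mem (hN : I.IsMatching N) (hM : I.IsMatching M) {a : A} {b : B}
    (h : (a, b) ∈ N) : I.womanNet N M b = I.womanVote M b a :=
  netVote_eq_vote (fun _ hu => hN.left_unique hu h) h (fun _ _ hu hv => hM.left_unique hu hv)
    fun _ hu hr => (I.womanRank_inj (hM.1 _ hu)).1 hr

theorem IsMatching.sum_add_sum [Fintype A] [Fintype B] (hN : I.IsMatching N) (F : A → ℤ)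
    (G : B → ℤ) :
    ∑ a, F a + ∑ b, G b = ∑ e ∈ N, (F e.1 + G e.2) +
      (∑ a ∈ Finset.univ \ N.image Prod.fst, F a +
        ∑ b ∈ Finset.univ \ N.image Prod.snd, G b) := by
  have h1 : ∑ a ∈ N.image Prod.fst, F a = ∑ e ∈ N, F e.1 :=
    Finset.sum_image fun e he f hf h => hN.2.1 e he f hf h
  have h2 : ∑ b ∈ N.image Prod.snd, G b = ∑ e ∈ N, G e.2 :=
    Finset.sum_image fun e he f hf h => hN.2.2 e he f hf h
  rw [← Finset.sum_sdiff (Finset.subset_univ (N.image Prod.fst)),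
    ← Finset.sum_sdiff (Finset.subset_univ (N.image Prod.snd)), h1, h2, Finset.sum_add_distrib]
  ring

theorem IsMatching.sum_nonpos [Fintype A] [Fintype B] (hN : I.IsMatching N) {F : A → ℤ}
    {G : B → ℤ} (hFG : ∀ a b, (a, b) ∈ N → F a + G b ≤ 0) (hF : ∀ a, (∀ b, (a, b) ∉ N) → F a ≤ 0)
    (hG : ∀ b, (∀ a, (a, b) ∉ N) → G b ≤ 0) : ∑ a, F a + ∑ b, G b ≤ 0 := by
  rw [hN.sum_add_sum]
  have h1 : ∑ e ∈ N, (F e.1 + G e.2) ≤ 0 := Finset.sum_nonpos fun e he => hFG _ _ he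
  have h2 : ∑ a ∈ Finset.univ \ N.image Prod.fst, F a ≤ 0 :=
    Finset.sum_nonpos fun a ha => hF a (by simpa using ha)
  have h3 : ∑ b ∈ Finset.univ \ N.image Prod.snd, G b ≤ 0 :=
    Finset.sum_nonpos fun b hb => hG b (by simpa using hb)
  linarith

theorem IsMatching.tight_of_sum_nonneg [Fintype A] [Fintype B] (hN : I.IsMatching N) {F : A → ℤ}
    {G : B → ℤ} (hFG : ∀ a b, (a, b) ∈ N → F a + G b ≤ 0) (hF : ∀ a, (∀ b, (a, b) ∉ N) → F a ≤ 0)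
    (hG : ∀ b, (∀ a, (a, b) ∉ N) → G b ≤ 0) (h : 0 ≤ ∑ a, F a + ∑ b, G b) :
    (∀ a b, (a, b) ∈ N → F a + G b = 0) ∧ (∀ a, (∀ b, (a, b) ∉ N) → F a = 0) ∧
      ∀ b, (∀ a, (a, b) ∉ N) → G b = 0 := by
  rw [hN.sum_add_sum] at h
  have k1 : ∀ e ∈ N, F e.1 + G e.2 ≤ 0 := fun e he => hFG _ _ he
  have k2 : ∀ a ∈ Finset.univ \ N.image Prod.fst, F a ≤ 0 := fun a ha => hF a (by simpa using ha)
  have k3 : ∀ b ∈ Finset.univ \ N.image Prod.snd, G b ≤ 0 := fun b hb => hG b (by simpa using hb)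
  have h1 := Finset.sum_nonpos k1
  have h2 := Finset.sum_nonpos k2
  have h3 := Finset.sum_nonpos k3
  have e1 := (Finset.sum_eq_zero_iff_of_nonpos k1).1 (by linarith)
  have e2 := (Finset.sum_eq_zero_iff_of_nonpos k2).1 (by linarith)
  have e3 := (Finset.sum_eq_zero_iff_of_nonpos k3).1 (by linarith)
  exact ⟨fun a b hab => e1 _ hab, fun a ha => e2 a (by simpa using ha),
    fun b hb => e3 b (by simpa using hb)⟩

variable (I) in
/-- A dual certificate for the popularity of `M` among the feasible matchings. -/
structure IsWitness (C : Set A) (M : Finset (A × B)) (y : A → ℤ) (z : B → ℤ) : Prop where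
  edge : ∀ a b, I.IsEdge (a, b) → I.manVote M a b + I.womanVote M b a ≤ y a + z b
  tight : ∀ a b, (a, b) ∈ M → y a + z b = 0
  man_free : ∀ a, (∀ b, (a, b) ∉ M) → y a = 0
  woman_free : ∀ b, (∀ a, (a, b) ∉ M) → z b = 0
  neg_one_le_man : ∀ a, a ∉ C → -1 ≤ y a
  neg_one_le_woman : ∀ b, -1 ≤ z b

namespace IsWitness

variable {C : Set A} {y : A → ℤ} {z : B → ℤ}

theorem sum_eq_zero [Fintype A] [Fintype B] (h : I.IsWitness C M y z) (hM : I.IsMatching M) :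
    ∑ a, y a + ∑ b, z b = 0 := by
  rw [hM.sum_add_sum, Finset.sum_eq_zero fun e he => h.tight _ _ he,
    Finset.sum_eq_zero fun a ha => h.man_free a (by simpa using ha),
    Finset.sum_eq_zero fun b hb => h.woman_free b (by simpa using hb)]
  rfl

/-- Weak duality term by term. A vertex that loses its partner votes -1, which the lower bounds on
`y` and `z` absorb. Critical men need no lower bound because `N` matches them. -/
theorem net_sub_le (h : I.IsWitness C M y z) (hM : I.IsMatching M) (hN : I.IsFeasible C N) :
    (∀ a b, (a, b) ∈ N → (I.manNet N M a - y a) + (I.womanNet N M b - z b) ≤ 0) ∧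
    (∀ a, (∀ b, (a, b) ∉ N) → I.manNet N M a - y a ≤ 0) ∧
    ∀ b, (∀ a, (a, b) ∉ N) → I.womanNet N M b - z b ≤ 0 := by
  refine ⟨fun a b hab => ?_, fun a ha => ?_, fun b hb => ?_⟩
  · rw [manNet_of_mem hN.1 hM hab, womanNet_of_mem hN.1 hM hab]
    linarith [h.edge a b (hN.1.1 _ hab)]
  · by_cases hM' : ∃ b, (a, b) ∈ M
    · obtain ⟨b, hb⟩ := hM'
      have := h.neg_one_le_man a fun hC => (hN.2 a hC).elim ha
      rw [manNet, netVote_of_free ha hb]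
      linarith
    · push Not at hM'
      rw [manNet, netVote_of_free_of_free ha hM', h.man_free a hM']
      rfl
  · by_cases hM' : ∃ a, (a, b) ∈ M
    · obtain ⟨a, ha⟩ := hM'
      have := h.neg_one_le_woman b
      rw [womanNet, netVote_of_free hb ha]
      linarith
    · push Not at hM'
      rw [womanNet, netVote_of_free_of_free hb hM', h.woman_free b hM']
      rfl

variable [Fintype A] [Fintype B]

theorem sum_net_sub (h : I.IsWitness C M y z) (hM : I.IsMatching M) :
    ∑ a, (I.manNet N M a - y a) + ∑ b, (I.womanNet N M b - z b) =
      (I.votes N M : ℤ) - I.votes M N := by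
  rw [votes_sub_votes, Finset.sum_sub_distrib, Finset.sum_sub_distrib]
  linarith [h.sum_eq_zero hM]

theorem isPopularFeasible (h : I.IsWitness C M y z) (hM : I.IsFeasible C M) :
    I.IsPopularFeasible C M := by
  refine ⟨hM, fun N hN => ?_⟩
  obtain ⟨h1, h2, h3⟩ := h.net_sub_le hM.1 hN
  have := hN.1.sum_nonpos h1 h2 h3
  rw [h.sum_net_sub hM.1] at this
  lia

/-- Complementary slackness for the feasible matchings that do not lose to `M`. -/
theorem tight_of_votes_le (h : I.IsWitness C M y z) (hM : I.IsMatching M)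
    (hN : I.IsFeasible C N) (hv : I.votes M N ≤ I.votes N M) :
    (∀ a b, (a, b) ∈ N → I.manVote M a b + I.womanVote M b a = y a + z b) ∧
    (∀ a, (∀ b, (a, b) ∉ N) → (∃ b, (a, b) ∈ M) → y a = -1) ∧
    (∀ b, (∀ a, (a, b) ∉ N) → (∃ a, (a, b) ∈ M) → z b = -1) := by
  obtain ⟨h1, h2, h3⟩ := h.net_sub_le hM hN
  obtain ⟨k1, k2, k3⟩ := hN.1.tight_of_sum_nonneg h1 h2 h3 (by rw [h.sum_net_sub hM]; lia)
  refine ⟨fun a b hab => ?_, fun a ha ⟨b, hb⟩ => ?_, fun b hb ⟨a, ha⟩ => ?_⟩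
  · have := k1 a b hab
    rw [manNet_of_mem hN.1 hM hab, womanNet_of_mem hN.1 hM hab] at this
    linarith
  · have := k2 a ha
    rw [manNet, netVote_of_free ha hb] at this
    linarith
  · have := k3 b hb
    rw [womanNet, netVote_of_free hb ha] at this
    linarith

end IsWitness

variable [Fintype A] [Fintype B] {C : Set A} {y : A → ℤ} {z : B → ℤ}

/-- A man who is matched in `M` and free in a popular `N` would have `y a = -1` by slackness, which
is odd. Hence every popular `N` matches all men of `M`. -/
theorem IsWitness.isMinSizePopularFeasible (h : I.IsWitness C M y z) (hM : I.IsFeasible C M)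
    (heven : ∀ a, Even (y a)) : I.IsMinSizePopularFeasible C M := by
  refine ⟨h.isPopularFeasible hM, fun N hN => hM.1.card_le_card fun a ha => ?_⟩
  by_contra! hfree
  have := (h.tight_of_votes_le hM.1 hN.1 (hN.2 M hM)).2.1 a hfree ha
  exact absurd (heven a) (by rw [this]; decide)

/-- Suppose that `N` does not lose and matches a man `a` who is free in `M` to `b`. Then `y a = 0`,
and slackness says that `z b` is `1` plus the vote of `b`. If `b` is matched in `M`, this is even
although `z b` is odd; otherwise it is 2 although `z b = 0`. So `N` matches only men of `M` and
cannot be larger. -/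
theorem IsWitness.isDominantFeasible (h : I.IsWitness C M y z) (hM : I.IsFeasible C M)
    (hodd : ∀ a b, (a, b) ∈ M → Odd (y a)) : I.IsDominantFeasible C M := by
  refine ⟨h.isPopularFeasible hM, fun N hN hlt => ?_⟩
  by_contra! hv
  refine absurd (hN.1.card_le_card (N := M) fun a ⟨b, hab⟩ => ?_) hlt.not_ge
  by_contra! hfree
  have e := (h.tight_of_votes_le hM.1 hN hv).1 a b hab
  have e1 : I.manVote M a b = 1 := vote_of_free hfree
  rw [h.man_free a hfree, e1] at e
  by_cases hb : ∃ a', (a', b) ∈ M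
  · obtain ⟨a', ha'⟩ := hb
    have e2 : I.womanVote M b a = -1 ∨ I.womanVote M b a = 1 :=
      vote_of_not (hfree b)
    obtain ⟨k, hk⟩ := hodd a' b ha'
    have := h.tight a' b ha'
    rcases e2 with e2 | e2 <;> rw [e2] at e <;> lia
  · push Not at hb
    have e2 : I.womanVote M b a = 1 := vote_of_free hb
    rw [e2, h.woman_free b hb] at e
    lia

end Net

end MarriageInstance

/-! ### Every popular feasible matching has a certificate -/

namespace MarriageInstance

variable {A B : Type*} {I : MarriageInstance A B}

section Existence

variable [Fintype A] [Fintype B] {M N : Finset (A × B)} {C : Set A}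

/-- A matching of the bipartite graph, completed by dummy partners to a perfect matching: the dummy
partner of an unmatched vertex is its own copy, and the copies of matched vertices are matched as
their originals. -/
theorem IsMatching.exists_completion (hM : I.IsMatching M) :
    ∃ τ : A ⊕ B ≃ B ⊕ A, (∀ a b, (a, b) ∈ M → τ (.inl a) = .inl b ∧ τ (.inr b) = .inr a) ∧
      (∀ a, (∀ b, (a, b) ∉ M) → τ (.inl a) = .inr a) ∧
      ∀ b, (∀ a, (a, b) ∉ M) → τ (.inr b) = .inl b := by
  classical
  let f : A ⊕ B → B ⊕ A := Sum.elim
    (fun a => if h : ∃ b, (a, b) ∈ M then .inl h.choose else .inr a)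
    (fun b => if h : ∃ a, (a, b) ∈ M then .inr h.choose else .inl b)
  have f1 : ∀ a b, (a, b) ∈ M → f (.inl a) = .inl b := fun a b hab => by
    have h : ∃ b, (a, b) ∈ M := ⟨b, hab⟩
    simp only [f, Sum.elim_inl, dif_pos h, hM.right_unique h.choose_spec hab]
  have f2 : ∀ a b, (a, b) ∈ M → f (.inr b) = .inr a := fun a b hab => by
    have h : ∃ a, (a, b) ∈ M := ⟨a, hab⟩
    simp only [f, Sum.elim_inr, dif_pos h, hM.left_unique h.choose_spec hab]
  have f3 : ∀ a, (∀ b, (a, b) ∉ M) → f (.inl a) = .inr a := fun a ha => by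
    simp only [f, Sum.elim_inl, dif_neg (not_exists.2 ha)]
  have f4 : ∀ b, (∀ a, (a, b) ∉ M) → f (.inr b) = .inl b := fun b hb => by
    simp only [f, Sum.elim_inr, dif_neg (not_exists.2 hb)]
  have hsurj : Function.Surjective f := by
    rintro (b | a)
    · by_cases h : ∃ a, (a, b) ∈ M
      · exact ⟨_, f1 _ _ h.choose_spec⟩
      · exact ⟨_, f4 b (not_exists.1 h)⟩
    · by_cases h : ∃ b, (a, b) ∈ M
      · exact ⟨_, f2 _ _ h.choose_spec⟩
      · exact ⟨_, f3 a (not_exists.1 h)⟩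
  have hbij := (Fintype.bijective_iff_surjective_and_card f).2
    ⟨hsurj, by simp [Nat.add_comm]⟩
  exact ⟨Equiv.ofBijective f hbij, fun a b h => ⟨f1 a b h, f2 a b h⟩, f3, f4⟩

variable [DecidableEq A] [DecidableEq B]

open Classical in
variable (I) in
/-- The gain of assigning `r` to `l` over the completion of `M`. Assignments that do not come from a
feasible matching get a penalty. -/
noncomputable def gain (C : Set A) (M : Finset (A × B)) : A ⊕ B → B ⊕ A → ℤ
  | .inl a, .inl b => if I.IsEdge (a, b) then I.manVote M a b + I.womanVote M b a
      else -(2 * (Fintype.card A + Fintype.card B))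
  | .inl a, .inr a' => if a = a' ∧ a ∉ C then I.manNet ∅ M a
      else -(2 * (Fintype.card A + Fintype.card B))
  | .inr b, .inl b' => if b = b' then I.womanNet ∅ M b
      else -(2 * (Fintype.card A + Fintype.card B))
  | .inr _, .inr _ => 0

theorem manNet_empty_of_mem {a : A} {b : B} (h : (a, b) ∈ M) : I.manNet ∅ M a = -1 :=
  netVote_of_free (by simp) h

theorem womanNet_empty_of_mem {a : A} {b : B} (h : (a, b) ∈ M) : I.womanNet ∅ M b = -1 :=
  netVote_of_free (by simp) h

theorem manNet_of_free {a : A} (h : ∀ b, (a, b) ∉ N) : I.manNet N M a = I.manNet ∅ M a := by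
  simp [manNet, h]

theorem womanNet_of_free {b : B} (h : ∀ a, (a, b) ∉ N) :
    I.womanNet N M b = I.womanNet ∅ M b := by
  simp [womanNet, h]

theorem manNet_empty_nonpos (a : A) : I.manNet ∅ M a ≤ 0 := by
  unfold manNet netVote; split_ifs <;> simp_all

theorem womanNet_empty_nonpos (b : B) : I.womanNet ∅ M b ≤ 0 := by
  unfold womanNet netVote; split_ifs <;> simp_all

theorem gain_le_two (l : A ⊕ B) (r : B ⊕ A) : I.gain C M l r ≤ 2 := by
  have h1 (a b) : I.manVote M a b ≤ 1 := vote_le_one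
  have h2 (a b) : I.womanVote M b a ≤ 1 := vote_le_one
  rcases l with a | b <;> rcases r with b' | a' <;> simp only [gain] <;> (try split_ifs)
  · linarith [h1 a b', h2 a b']
  · lia
  · linarith [I.manNet_empty_nonpos (M := M) a]
  · lia
  · linarith [I.womanNet_empty_nonpos (M := M) b]
  · lia
  · lia

theorem sum_gain_nonpos (hM : I.IsPopularFeasible C M) (σ : A ⊕ B ≃ B ⊕ A) :
    ∑ l, I.gain C M l (σ l) ≤ 0 := by
  classical
  by_cases hbad : ∃ l, I.gain C M l (σ l) = -(2 * (Fintype.card A + Fintype.card B))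
  -- A single penalty outweighs the gain of at most 2 from each other position.
  · obtain ⟨l, hl⟩ := hbad
    rw [← Finset.add_sum_erase _ _ (Finset.mem_univ l), hl]
    have := Finset.sum_le_card_nsmul (Finset.univ.erase l) (fun l => I.gain C M l (σ l)) 2
      fun l _ => gain_le_two _ _
    have h2 : (Finset.univ.erase l).card ≤ Fintype.card A + Fintype.card B := by
      rw [← Fintype.card_sum]; exact Finset.card_erase_le
    simp only [nsmul_eq_mul] at this
    lia
  push Not at hbad
  let N : Finset (A × B) := Finset.univ.filter fun e => σ (.inl e.1) = .inl e.2
  have memN (a b) : (a, b) ∈ N ↔ σ (.inl a) = .inl b := by simp [N]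
  have s1 (a b) (h : σ (.inl a) = .inl b) : I.IsEdge (a, b) := by
    by_contra hne
    exact hbad (.inl a) (by simp [h, gain, hne])
  have s2 (a a') (h : σ (.inl a) = .inr a') : a = a' ∧ a ∉ C := by
    by_contra hne
    exact hbad (.inl a) (by rw [h, gain, if_neg hne])
  have s3 (b b') (h : σ (.inr b) = .inl b') : b = b' := by
    by_contra hne
    exact hbad (.inr b) (by rw [h, gain, if_neg hne])
  have hN : I.IsFeasible C N := by
    refine ⟨⟨fun e he => s1 _ _ ((memN _ _).1 he), ?_, ?_⟩, fun a ha => ?_⟩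
    · rintro ⟨a, b⟩ he ⟨a', b'⟩ hf rfl
      rw [memN] at he hf
      simpa using he.symm.trans hf
    · rintro ⟨a, b⟩ he ⟨a', b'⟩ hf rfl
      rw [memN] at he hf
      simpa using σ.injective (he.trans hf.symm)
    · rcases h : σ (.inl a) with b | a'
      · exact ⟨b, (memN _ _).2 h⟩
      · exact absurd ha (s2 _ _ h).2
  -- Without penalties the assignment encodes the feasible matching `N`: a vertex free in `N` is
  -- assigned to its own dummy, and the dummies of matched vertices contribute 0.
  have key : ∑ l, I.gain C M l (σ l) = (I.votes N M : ℤ) - I.votes M N := by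
    rw [votes_sub_votes, Fintype.sum_sum_type, hN.1.sum_add_sum,
      hN.1.sum_add_sum (I.manNet N M)]
    congr 1
    · refine Finset.sum_congr rfl ?_
      rintro ⟨a, b⟩ he
      have h1 := (memN _ _).1 he
      rw [manNet_of_mem hN.1 hM.1.1 he, womanNet_of_mem hN.1 hM.1.1 he]
      simp only [h1, gain, if_pos (s1 _ _ h1)]
      rcases h2 : σ (.inr b) with b' | a'
      · rw [← s3 _ _ h2] at h2
        simpa using σ.injective (h1.trans h2.symm)
      · simp
    congr 1
    · refine Finset.sum_congr rfl fun a ha => ?_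
      have hfree : ∀ b, (a, b) ∉ N := by simpa using ha
      rw [manNet_of_free hfree]
      rcases h : σ (.inl a) with b | a'
      · exact absurd ((memN _ _).2 h) (hfree b)
      · rw [gain, if_pos (s2 _ _ h)]
    · refine Finset.sum_congr rfl fun b hb => ?_
      have hfree : ∀ a, (a, b) ∉ N := by simpa using hb
      rw [womanNet_of_free hfree]
      obtain ⟨l, hl⟩ := σ.surjective (.inl b)
      rcases l with a | b'
      · exact absurd ((memN _ _).2 hl) (hfree a)
      · obtain rfl := s3 _ _ hl
        rw [hl, gain, if_pos rfl]
  rw [key]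
  have := hM.2 N hN
  lia

theorem gain_completion (hM : I.IsFeasible C M) {τ : A ⊕ B ≃ B ⊕ A}
    (h1 : ∀ a b, (a, b) ∈ M → τ (.inl a) = .inl b ∧ τ (.inr b) = .inr a)
    (h2 : ∀ a, (∀ b, (a, b) ∉ M) → τ (.inl a) = .inr a)
    (h3 : ∀ b, (∀ a, (a, b) ∉ M) → τ (.inr b) = .inl b) (l : A ⊕ B) :
    I.gain C M l (τ l) = 0 := by
  rcases l with a | b
  · by_cases h : ∃ b, (a, b) ∈ M
    · obtain ⟨b, hb⟩ := h
      have e1 : I.manVote M a b = 0 := vote_self hb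
      have e2 : I.womanVote M b a = 0 := vote_self hb
      rw [(h1 a b hb).1, gain, if_pos (hM.1.1 _ hb), e1, e2]
      rfl
    · push Not at h
      rw [h2 a h, gain, if_pos ⟨rfl, fun hC => (hM.2 a hC).elim h⟩]
      exact netVote_of_free_of_free (by simp) h
  · by_cases h : ∃ a, (a, b) ∈ M
    · obtain ⟨a, ha⟩ := h
      rw [(h1 a b ha).2, gain]
    · push Not at h
      rw [h3 b h, gain, if_pos rfl]
      exact netVote_of_free_of_free (by simp) h

/-- Every popular feasible matching has a dual certificate of polynomially bounded size. -/
theorem IsPopularFeasible.exists_isWitness (hM : I.IsPopularFeasible C M) :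
    ∃ y z, I.IsWitness C M y z ∧
      ∀ a, -(2 * (Fintype.card A + Fintype.card B) : ℤ) ≤ y a := by
  classical
  obtain ⟨τ, h1, h2, h3⟩ := hM.1.1.exists_completion
  have h0 := gain_completion hM.1 h1 h2 h3
  obtain ⟨y, z, hyz, ht⟩ := exists_dual_of_optimal_assignment (I.gain C M) τ fun σ => by
    simpa only [h0, Finset.sum_const_zero] using sum_gain_nonpos hM σ
  simp only [h0] at ht
  rcases isEmpty_or_nonempty A with hA | hA
  · have hfree : ∀ b a, (a, b) ∉ M := fun b a => hA.elim a
    exact ⟨fun _ => 0, fun _ => 0, ⟨fun a => hA.elim a, fun a => hA.elim a, fun a => hA.elim a,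
      fun _ _ => rfl, fun a => hA.elim a, fun _ => by simp⟩, fun a => hA.elim a⟩
  -- Dummy pairs have gain 0, so `-z (.inr a) ≤ y (.inr b)` for all `a` and `b`, and one constant
  -- `s` separates the two families. Shifting by `s` normalises the potentials of the dummies away.
  obtain ⟨s, hs1, hs2⟩ : ∃ s : ℤ, (∀ a, -z (.inr a) ≤ s) ∧ ∀ b, s ≤ y (.inr b) := by
    obtain ⟨a, -, ha⟩ := Finset.exists_max_image Finset.univ (fun a : A => -z (.inr a))
      Finset.univ_nonempty
    refine ⟨-z (.inr a), fun a' => ha a' (Finset.mem_univ _), fun b => ?_⟩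
    have := hyz (.inr b) (.inr a)
    rw [gain] at this
    linarith
  have t1 {a b} (hab : (a, b) ∈ M) : y (.inl a) + z (.inl b) = 0 ∧ y (.inr b) + z (.inr a) = 0 := by
    have e1 := ht (.inl a)
    have e2 := ht (.inr b)
    rw [(h1 a b hab).1] at e1
    rw [(h1 a b hab).2] at e2
    exact ⟨e1, e2⟩
  let y' : A → ℤ := fun a => if ∃ b, (a, b) ∈ M then y (.inl a) - s else 0
  let z' : B → ℤ := fun b => if ∃ a, (a, b) ∈ M then z (.inl b) + s else 0
  -- Resetting a free vertex to 0 can only raise its potential: tightness with its own dummy puts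
  -- the shifted value at or below 0.
  have hy' (a) : y (.inl a) - s ≤ y' a := by
    by_cases h : ∃ b, (a, b) ∈ M
    · simp only [y', if_pos h, le_refl]
    · simp only [y', if_neg h]
      have := ht (.inl a)
      rw [h2 a (not_exists.1 h)] at this
      linarith [hs1 a]
  have hz' (b) : z (.inl b) + s ≤ z' b := by
    by_cases h : ∃ a, (a, b) ∈ M
    · simp only [z', if_pos h, le_refl]
    · simp only [z', if_neg h]
      have := ht (.inr b)
      rw [h3 b (not_exists.1 h)] at this
      linarith [hs2 b]
  have drop_man {a b} (hab : (a, b) ∈ M) : I.gain C M (.inl a) (.inr a) ≤ y' a := by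
    have := hyz (.inl a) (.inr a)
    linarith [hy' a, hs2 b, (t1 hab).2]
  have hwit : I.IsWitness C M y' z' := by
    refine ⟨fun a b hab => ?_, fun a b hab => ?_, fun a ha => if_neg (not_exists.2 ha),
      fun b hb => if_neg (not_exists.2 hb), fun a ha => ?_, fun b => ?_⟩
    · have := hyz (.inl a) (.inl b)
      rw [gain, if_pos hab] at this
      linarith [hy' a, hz' b]
    · simp only [y', z', if_pos (⟨b, hab⟩ : ∃ b, (a, b) ∈ M),
        if_pos (⟨a, hab⟩ : ∃ a, (a, b) ∈ M)]
      linarith [(t1 hab).1]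
    · by_cases h : ∃ b, (a, b) ∈ M
      · obtain ⟨b, hab⟩ := h
        have := drop_man hab
        rwa [gain, if_pos ⟨rfl, ha⟩, manNet_empty_of_mem hab] at this
      · simp only [y', if_neg h]
        lia
    · by_cases h : ∃ a, (a, b) ∈ M
      · obtain ⟨a, hab⟩ := h
        have := hyz (.inr b) (.inl b)
        rw [gain, if_pos rfl, womanNet_empty_of_mem hab] at this
        linarith [hz' b, hs1 a, (t1 hab).2]
      · simp only [z', if_neg h]
        lia
  refine ⟨y', z', hwit, fun a => ?_⟩
  by_cases h : ∃ b, (a, b) ∈ M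
  · obtain ⟨b, hab⟩ := h
    -- For a critical man the penalty itself serves as the lower bound. It later limits the number
    -- of levels needed.
    by_cases hC : a ∈ C
    · have := drop_man hab
      rwa [gain, if_neg fun h => h.2 hC] at this
    · have := hwit.neg_one_le_man a hC
      have : 0 < Fintype.card A := Fintype.card_pos
      lia
  · simp only [y', if_neg h]
    lia

end Existence

end MarriageInstance

/-! ### Stable matchings of a multigraph -/

/-- `r` compares the edges at the same vertex, where `v` maps every edge to its vertex. It is a
strict order, and it is linear on the edges in `E` at any given vertex. -/
structure IsStarOrder {ε α : Type*} (E : Set ε) (v : ε → α) (r : ε → ε → Bool) : Prop where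
  same : ∀ {f g}, r f g → v f = v g
  irrefl : ∀ f, ¬ r f f
  trans : ∀ {f g h}, r f g → r g h → r f h
  total : ∀ {f g}, f ∈ E → g ∈ E → v f = v g → f ≠ g → r f g ∨ r g f

/-- `S` is a stable matching of the multigraph with the edge set `T`. -/
structure IsStableIn {ε α β : Type*} (m : ε → α) (w : ε → β) (mb wb : ε → ε → Bool)
    (T S : Set ε) : Prop where
  subset : S ⊆ T
  injOn_man : Set.InjOn m S
  injOn_woman : Set.InjOn w S
  dominated : ∀ f ∈ T, f ∉ S → ∃ g ∈ S, mb g f ∨ wb g f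

section GaleShapley

variable {ε : Type*}

/-- No edge in `R` is better than `f` for its man. -/
def isProposed (mb : ε → ε → Bool) (R : List ε) (f : ε) : Bool := !R.any fun g => mb g f

/-- The edge `g` is worse for its woman than some edge proposed to her. -/
def isRejected (mb wb : ε → ε → Bool) (R : List ε) (g : ε) : Bool :=
  R.any fun f => wb f g && isProposed mb R f

/-- One round of the Gale-Shapley algorithm: delete the rejected edges. -/
def galeShapleyStep (mb wb : ε → ε → Bool) (R : List ε) : List ε :=
  R.filter fun g => !isRejected mb wb R g

/-- The edges that survive the Gale-Shapley algorithm. -/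
def galeShapley (mb wb : ε → ε → Bool) (L : List ε) : List ε :=
  (galeShapleyStep mb wb)^[L.length] L

variable {mb wb : ε → ε → Bool} {R L : List ε} {f g e : ε}

theorem isProposed_iff : isProposed mb R f ↔ ∀ g ∈ R, ¬ mb g f := by
  simp [isProposed]

theorem isRejected_iff : isRejected mb wb R g ↔ ∃ f ∈ R, wb f g ∧ isProposed mb R f := by
  simp [isRejected]

theorem mem_galeShapleyStep :
    g ∈ galeShapleyStep mb wb R ↔ g ∈ R ∧ ¬ isRejected mb wb R g := by
  simp [galeShapleyStep]

/-- A round that changes the list shortens it, so as many rounds as there are edges suffice. -/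
theorem galeShapleyStep_iterate_fixed (n : ℕ) (R : List ε) (h : R.length ≤ n) :
    galeShapleyStep mb wb ((galeShapleyStep mb wb)^[n] R) = (galeShapleyStep mb wb)^[n] R := by
  induction n generalizing R with
  | zero => simp [List.length_eq_zero_iff.1 (Nat.le_zero.1 h), galeShapleyStep]
  | succ n ih =>
    by_cases hfix : galeShapleyStep mb wb R = R
    · rw [Function.iterate_fixed hfix, hfix]
    · rw [Function.iterate_succ_apply]
      refine ih _ (Nat.le_of_lt_succ (lt_of_lt_of_le (lt_of_le_of_ne ?_ ?_) h))
      · exact List.length_filter_le _ _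
      · exact fun hlen => hfix (List.filter_eq_self.2 (List.length_filter_eq_length_iff.1 hlen))

theorem galeShapleyStep_galeShapley :
    galeShapleyStep mb wb (galeShapley mb wb L) = galeShapley mb wb L :=
  galeShapleyStep_iterate_fixed _ _ le_rfl

theorem iterate_invariant {X : Type*} {step : X → X} {p : X → Prop} (h : ∀ x, p x → p (step x))
    (n : ℕ) (x : X) (hx : p x) : p (step^[n] x) := by
  induction n generalizing x with
  | zero => exact hx
  | succ n ih => exact ih _ (h x hx)

theorem galeShapley_subset : galeShapley mb wb L ⊆ L :=
  iterate_invariant (p := fun R => R ⊆ L)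
    (fun _ h _ hf => h (mem_galeShapleyStep.1 hf).1) _ _ fun _ h => h

namespace IsStarOrder

variable {α : Type*} {E : Set ε} {v : ε → α} {r : ε → ε → Bool}

theorem asymm (h : IsStarOrder E v r) (hfg : r f g) : ¬ r g f :=
  fun hgf => h.irrefl f (h.trans hfg hgf)

/-- A strict order on a finite set is well-founded. Applied to the order of the women, the result is
the best proposal to a woman. -/
theorem exists_isProposed (h : IsStarOrder E v r) (hf : f ∈ R) :
    ∃ g ∈ R, isProposed r R g ∧ (g = f ∨ r g f) := by
  let X := {g : ε // g ∈ R ∧ (g = f ∨ r g f)}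
  let s : X → X → Prop := fun a b => r a.1 b.1
  have : Finite X := ((List.finite_toSet R).subset fun g hg => hg.1 :
    {g | g ∈ R ∧ (g = f ∨ r g f)}.Finite)
  have : IsTrans X s := ⟨fun _ _ _ h1 h2 => h.trans h1 h2⟩
  have : Std.Irrefl s := ⟨fun a => h.irrefl a.1⟩
  obtain ⟨⟨g, hg, hgf⟩, -, hmin⟩ := (Finite.wellFounded_of_trans_of_irrefl s).has_min Set.univ
    ⟨⟨f, hf, .inl rfl⟩, trivial⟩
  refine ⟨g, hg, isProposed_iff.2 fun k hk hkg => ?_, hgf⟩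
  refine hmin ⟨k, hk, .inr ?_⟩ trivial hkg
  rcases hgf with rfl | hgf
  · exact hkg
  · exact h.trans hkg hgf

end IsStarOrder

variable {α β : Type*} {E : Set ε} {m : ε → α} {w : ε → β}

/-- The set of the edges that are proposed when the Gale-Shapley algorithm stops. -/
def galeShapleyMatching (mb wb : ε → ε → Bool) (L : List ε) : Set ε :=
  {f | f ∈ galeShapley mb wb L ∧ isProposed mb (galeShapley mb wb L) f}

/-- The invariant is that every deleted edge is worse for its woman than some current proposal. At
the fixed point nothing is rejected, so each woman has at most one proposal; a surviving edge that
is not proposed is dominated at its man, a deleted one at its woman. -/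
theorem isStableIn_galeShapleyMatching (hm : IsStarOrder E m mb) (hw : IsStarOrder E w wb)
    (hL : ∀ f ∈ L, f ∈ E) :
    IsStableIn m w mb wb {f | f ∈ L} (galeShapleyMatching mb wb L) := by
  have hinv : ∀ g ∈ L, g ∉ galeShapley mb wb L →
      ∃ f ∈ galeShapley mb wb L, isProposed mb (galeShapley mb wb L) f ∧ wb f g := by
    refine iterate_invariant (p := fun R => ∀ g ∈ L, g ∉ R →
      ∃ f ∈ R, isProposed mb R f ∧ wb f g) (fun R ih g hgL hg => ?_) _ _
      fun g h h' => absurd h h'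
    obtain ⟨f, hfR, hfp, hfg⟩ : ∃ f ∈ R, isProposed mb R f ∧ wb f g := by
      by_cases hgR : g ∈ R
      · obtain ⟨f, h1, h2, h3⟩ := isRejected_iff.1 (not_not.1 fun h =>
          hg (mem_galeShapleyStep.2 ⟨hgR, h⟩))
        exact ⟨f, h1, h3, h2⟩
      · exact ih g hgL hgR
    -- The best proposal to the woman survives the round, and it stays proposed because deletions
    -- only remove its rivals.
    obtain ⟨f', hf', hbest, hle⟩ := hw.exists_isProposed (R := R.filter (isProposed mb R))
      (f := f) (List.mem_filter.2 ⟨hfR, hfp⟩)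
    obtain ⟨hf'R, hf'p⟩ := List.mem_filter.1 hf'
    refine ⟨f', mem_galeShapleyStep.2 ⟨hf'R, fun hrej => ?_⟩, isProposed_iff.2 fun k hk =>
      isProposed_iff.1 hf'p k (mem_galeShapleyStep.1 hk).1, ?_⟩
    · obtain ⟨k, hk, hkf, hkp⟩ := isRejected_iff.1 hrej
      exact isProposed_iff.1 hbest k (List.mem_filter.2 ⟨hk, hkp⟩) hkf
    · rcases hle with rfl | hle
      · exact hfg
      · exact hw.trans hle hfg
  have hEq := galeShapleyStep_galeShapley (mb := mb) (wb := wb) (L := L)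
  refine ⟨fun f hf => galeShapley_subset hf.1, fun f hf g hg hfg => ?_,
    fun f hf g hg hfg => ?_, fun f hf hfS => ?_⟩
  · by_contra hne
    rcases hm.total (hL f (galeShapley_subset hf.1)) (hL g (galeShapley_subset hg.1)) hfg hne
      with h | h
    · exact isProposed_iff.1 hg.2 f hf.1 h
    · exact isProposed_iff.1 hf.2 g hg.1 h
  · by_contra hne
    have not_rej {f} (hf : f ∈ galeShapleyMatching mb wb L) :
        ¬ isRejected mb wb (galeShapley mb wb L) f :=
      (mem_galeShapleyStep.1 (hEq.symm ▸ hf.1)).2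
    rcases hw.total (hL f (galeShapley_subset hf.1)) (hL g (galeShapley_subset hg.1)) hfg hne
      with h | h
    · exact not_rej hg (isRejected_iff.2 ⟨f, hf.1, h, hf.2⟩)
    · exact not_rej hf (isRejected_iff.2 ⟨g, hg.1, h, hg.2⟩)
  · by_cases hfR : f ∈ galeShapley mb wb L
    · obtain ⟨g, hg, hgp, rfl | hgf⟩ := hm.exists_isProposed hfR
      · exact absurd ⟨hg, hgp⟩ hfS
      · exact ⟨g, ⟨hg, hgp⟩, .inl hgf⟩
    · obtain ⟨g, hg, hgp, hgf⟩ := hinv f hf hfR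
      exact ⟨g, ⟨hg, hgp⟩, .inr hgf⟩

theorem exists_isStableIn (hm : IsStarOrder E m mb) (hw : IsStarOrder E w wb) {T : Set ε}
    (hT : T.Finite) (hTE : T ⊆ E) : ∃ S, IsStableIn m w mb wb T S := by
  have := isStableIn_galeShapleyMatching (L := hT.toFinset.toList) hm hw fun f hf =>
    hTE (by simpa using hf)
  exact ⟨_, by simpa using this⟩

/-- The Gale-Shapley algorithm never deletes an edge of a stable matching. -/
theorem IsStableIn.subset_galeShapley {S : Set ε} (hw : IsStarOrder E w wb)
    (hS : IsStableIn m w mb wb {f | f ∈ L} S) : ∀ f ∈ S, f ∈ galeShapley mb wb L := by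
  refine (iterate_invariant (p := fun R => R ⊆ L ∧ ∀ f ∈ S, f ∈ R) (fun R ⟨hRL, ih⟩ => ⟨fun f hf =>
    hRL (mem_galeShapleyStep.1 hf).1, fun g hg => ?_⟩) _ _ ⟨fun _ h => h, fun f hf =>
    hS.subset hf⟩).2
  -- If `g ∈ S` were rejected because of a proposal `f`, then `f` would block `S`: all of `S` still
  -- survives, so its man has nothing better in `S`, and its woman has only `g`, which is worse.
  refine mem_galeShapleyStep.2 ⟨ih g hg, fun hrej => ?_⟩
  obtain ⟨f, hf, hfg, hfp⟩ := isRejected_iff.1 hrej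
  by_cases hfS : f ∈ S
  · obtain rfl := hS.injOn_woman hfS hg (hw.same hfg)
    exact hw.irrefl _ hfg
  · obtain ⟨h, hhS, hhf | hhf⟩ := hS.dominated f (hRL hf) hfS
    · exact isProposed_iff.1 hfp h (ih h hhS) hhf
    · obtain rfl := hS.injOn_woman hhS hg ((hw.same hhf).trans (hw.same hfg))
      exact hw.asymm hfg hhf

/-- If the edges that are worse for the woman of `e` than `e` are deleted, then the matching of the
Gale-Shapley algorithm contains `e` whenever some stable matching does. -/
theorem IsStableIn.mem_galeShapleyMatching {S : Set ε} (hm : IsStarOrder E m mb)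
    (hw : IsStarOrder E w wb) (hL : ∀ f ∈ L, f ∈ E) (hS : IsStableIn m w mb wb {f | f ∈ L} S)
    (he : e ∈ S) : e ∈ galeShapleyMatching mb wb (L.filter fun f => !wb e f) := by
  set T := L.filter fun f => !wb e f
  have memT {f} : f ∈ T ↔ f ∈ L ∧ ¬ wb e f := by simp [T]
  have hST : IsStableIn m w mb wb {f | f ∈ T} S := by
    refine ⟨fun f hf => memT.2 ⟨hS.subset hf, fun hef => ?_⟩, hS.injOn_man, hS.injOn_woman,
      fun f hf => hS.dominated f (memT.1 hf).1⟩
    obtain rfl := hS.injOn_woman he hf (hw.same hef)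
    exact hw.irrefl _ hef
  have hTE : ∀ f ∈ T, f ∈ E := fun f hf => hL f (memT.1 hf).1
  have hG := isStableIn_galeShapleyMatching hm hw hTE
  have hsurv := hST.subset_galeShapley hw
  have hfin : S.Finite := (List.finite_toSet T).subset hST.subset
  have hGfin : (galeShapleyMatching mb wb T).Finite := (List.finite_toSet T).subset hG.subset
  have hdom {s} (hs : s ∈ galeShapleyMatching mb wb T) (hsS : s ∉ S) : ∃ h ∈ S, wb h s := by
    obtain ⟨h, hh, hhs | hhs⟩ := hST.dominated s (hG.subset hs) hsS
    · exact absurd hhs (isProposed_iff.1 hs.2 h (hsurv h hh))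
    · exact ⟨h, hh, hhs⟩
  -- A rural hospitals argument. The algorithm matches at least the men of `S` and at most the women
  -- of `S`; counting edges shows that it matches exactly the women of `S`, among them the woman of
  -- `e`.
  have hwsub : w '' galeShapleyMatching mb wb T ⊆ w '' S := by
    rintro _ ⟨s, hs, rfl⟩
    by_cases hsS : s ∈ S
    · exact ⟨s, hsS, rfl⟩
    · obtain ⟨h, hh, hhs⟩ := hdom hs hsS
      exact ⟨h, hh, hw.same hhs⟩
  have hmsub : m '' S ⊆ m '' galeShapleyMatching mb wb T := by
    rintro _ ⟨s, hs, rfl⟩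
    obtain ⟨g, hg, hgp, rfl | hgs⟩ := hm.exists_isProposed (hsurv s hs)
    · exact ⟨g, ⟨hg, hgp⟩, rfl⟩
    · exact ⟨g, ⟨hg, hgp⟩, hm.same hgs⟩
  have hw_eq : w '' galeShapleyMatching mb wb T = w '' S := by
    refine Set.eq_of_subset_of_ncard_le hwsub ?_ (hfin.image w)
    rw [hS.injOn_woman.ncard_image, hG.injOn_woman.ncard_image, ← hS.injOn_man.ncard_image,
      ← hG.injOn_man.ncard_image]
    exact Set.ncard_le_ncard hmsub (hGfin.image m)
  obtain ⟨s, hs, hse⟩ : w e ∈ w '' galeShapleyMatching mb wb T := hw_eq ▸ ⟨e, he, rfl⟩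
  by_cases hne : s = e
  · exact hne ▸ hs
  -- The edge `s` found at the woman of `e` is not worse than `e`, since worse ones were deleted. If
  -- it differed from `e`, stability of `S` would make it worse.
  have hes : ¬ wb e s := (memT.1 (hG.subset hs)).2
  have hsS : s ∉ S := fun h => hne (hS.injOn_woman h he hse)
  obtain ⟨h, hh, hhs⟩ := hdom hs hsS
  obtain rfl := hS.injOn_woman hh he ((hw.same hhs).trans hse)
  exact absurd hhs hes

/-- Once `e` is in the matching, it dominates at its woman every edge that was deleted beforehand,
so these edges may be put back. -/
theorem isStableIn_of_mem_galeShapleyMatching (hm : IsStarOrder E m mb)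
    (hw : IsStarOrder E w wb) (hL : ∀ f ∈ L, f ∈ E)
    (he : e ∈ galeShapleyMatching mb wb (L.filter fun f => !wb e f)) :
    IsStableIn m w mb wb {f | f ∈ L}
      (galeShapleyMatching mb wb (L.filter fun f => !wb e f)) := by
  have hG := isStableIn_galeShapleyMatching hm hw (L := L.filter fun f => !wb e f)
    fun f hf => hL f (List.mem_filter.1 hf).1
  refine ⟨fun f hf => (List.mem_filter.1 (hG.subset hf)).1, hG.injOn_man, hG.injOn_woman,
    fun f hf hfS => ?_⟩
  by_cases hef : wb e f
  · exact ⟨e, he, .inr hef⟩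
  · exact hG.dominated f (List.mem_filter.2 ⟨hf, by simp [hef]⟩) hfS

end GaleShapley

theorem rank_lt_of_vote_eq_one {X : Type*} {rank : X → ℕ} {P : X → Prop} {x x' : X}
    (hinj : rank x = rank x' → x = x') (h' : P x') (h : vote rank P x = 1) :
    rank x < rank x' := by
  by_contra hlt
  by_cases he : rank x = rank x'
  · rw [vote_self (hinj he ▸ h')] at h
    exact absurd h (by decide)
  · rw [vote, if_pos (⟨x', h', by lia⟩ : ∃ x', P x' ∧ rank x' < rank x)] at h
    split_ifs at h
    all_goals simp at h

theorem rank_lt_of_vote_eq_neg_one {X : Type*} {rank : X → ℕ} {P : X → Prop} {x x' : X}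
    (hP : ∀ x, P x → x = x') (h : vote rank P x = -1) : rank x' < rank x := by
  unfold vote at h
  split_ifs at h with h1 h2
  obtain ⟨u, hu, hlt⟩ := h2
  rwa [hP u hu] at hlt

theorem vote_eq_zero_iff {X : Type*} {rank : X → ℕ} {P : X → Prop} {x : X} :
    vote rank P x = 0 ↔ P x := by
  unfold vote; split_ifs <;> simp_all

/-! ### The multigraph of levelled edges -/

namespace MarriageInstance

variable {A B : Type*} [DecidableEq A] [DecidableEq B]

section Levels

variable (I : MarriageInstance A B)

/-- The man of `f` and `g` prefers `f`: the edge `f` has a lower level, or the same level and a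
better partner. -/
def manBetter (f g : A × B × ℕ) : Bool :=
  decide (f.1 = g.1 ∧ (f.2.2 < g.2.2 ∨
    f.2.2 = g.2.2 ∧ I.manRank f.1 f.2.1 < I.manRank f.1 g.2.1))

/-- The woman of `f` and `g` prefers `f`: the edge `f` has a higher level, or the same level and a
better partner. -/
def womanBetter (f g : A × B × ℕ) : Bool :=
  decide (f.2.1 = g.2.1 ∧ (g.2.2 < f.2.2 ∨
    f.2.2 = g.2.2 ∧ I.womanRank f.2.1 f.1 < I.womanRank f.2.1 g.1))

/-- The multigraph that has a copy of every edge `(a, b)` at each level up to `K` if `a` is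
critical and up to `c` otherwise. -/
def levelEdges (C : Set A) (c K : ℕ) : Set (A × B × ℕ) :=
  {f | I.IsEdge (f.1, f.2.1) ∧ (f.1 ∈ C → f.2.2 ≤ K) ∧ (f.1 ∉ C → f.2.2 ≤ c)}

variable {I}

theorem manBetter_iff {f g : A × B × ℕ} : I.manBetter f g ↔ f.1 = g.1 ∧ (f.2.2 < g.2.2 ∨
    f.2.2 = g.2.2 ∧ I.manRank f.1 f.2.1 < I.manRank f.1 g.2.1) := by
  simp [manBetter]

theorem womanBetter_iff {f g : A × B × ℕ} : I.womanBetter f g ↔ f.2.1 = g.2.1 ∧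
    (g.2.2 < f.2.2 ∨ f.2.2 = g.2.2 ∧ I.womanRank f.2.1 f.1 < I.womanRank f.2.1 g.1) := by
  simp [womanBetter]

variable (I) in
theorem isStarOrder_manBetter :
    IsStarOrder {f : A × B × ℕ | I.IsEdge (f.1, f.2.1)} Prod.fst I.manBetter where
  same h := (manBetter_iff.1 h).1
  irrefl f h := by simp [manBetter_iff] at h
  trans {f g h} h1 h2 := by
    rw [manBetter_iff] at *
    obtain ⟨e1, h1⟩ := h1
    obtain ⟨e2, h2⟩ := h2
    rw [← e1] at h2
    exact ⟨e1.trans e2, by lia⟩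
  total {f g} hf hg hfg hne := by
    obtain ⟨a, b, i⟩ := f
    obtain ⟨a', b', i'⟩ := g
    obtain rfl : a = a' := hfg
    simp only [manBetter_iff, true_and]
    by_cases hi : i = i'
    · have : I.manRank a b ≠ I.manRank a b' := fun h =>
        hne (by rw [show b = b' from (I.manRank_inj hf).1 h, hi])
      lia
    · lia

variable (I) in
theorem isStarOrder_womanBetter :
    IsStarOrder {f : A × B × ℕ | I.IsEdge (f.1, f.2.1)} (fun f => f.2.1) I.womanBetter where
  same h := (womanBetter_iff.1 h).1
  irrefl f h := by simp [womanBetter_iff] at h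
  trans {f g h} h1 h2 := by
    rw [womanBetter_iff] at *
    obtain ⟨e1, h1⟩ := h1
    obtain ⟨e2, h2⟩ := h2
    rw [← e1] at h2
    exact ⟨e1.trans e2, by lia⟩
  total {f g} hf hg hfg hne := by
    obtain ⟨a, b, i⟩ := f
    obtain ⟨a', b', i'⟩ := g
    obtain rfl : b = b' := hfg
    simp only [womanBetter_iff, true_and]
    by_cases hi : i = i'
    · have : I.womanRank b a ≠ I.womanRank b a' := fun h =>
        hne (by rw [show a = a' from (I.womanRank_inj hf).1 h, hi])
      lia
    · lia

variable (I) in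
/-- `S` is a stable matching of the multigraph `T` of levelled edges. -/
abbrev IsLevelStable (T S : Set (A × B × ℕ)) : Prop :=
  IsStableIn Prod.fst (fun f => f.2.1) I.manBetter I.womanBetter T S

theorem finite_levelEdges [Finite A] [Finite B] (C : Set A) (c K : ℕ) :
    (I.levelEdges C c K).Finite := by
  refine (Set.finite_univ.prod (Set.finite_univ.prod (Set.finite_Iic (max c K)))).subset ?_
  rintro ⟨a, b, i⟩ ⟨-, h1, h2⟩
  refine ⟨trivial, trivial, ?_⟩
  by_cases h : a ∈ C
  · exact (h1 h).trans (le_max_right _ _)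
  · exact (h2 h).trans (le_max_left _ _)

end Levels

variable {I : MarriageInstance A B} {C : Set A} {c K : ℕ} {S : Set (A × B × ℕ)}

/-! ### From stable matchings to certificates -/

section StableToPopular

theorem IsLevelStable.eq_of_man {T : Set (A × B × ℕ)} (hS : I.IsLevelStable T S) {a : A}
    {b b' : B} {i i' : ℕ} (h : (a, b, i) ∈ S) (h' : (a, b', i') ∈ S) : b = b' ∧ i = i' := by
  simpa using hS.injOn_man h h' rfl

theorem IsLevelStable.eq_of_woman {T : Set (A × B × ℕ)} (hS : I.IsLevelStable T S) {a a' : A}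
    {b : B} {i i' : ℕ} (h : (a, b, i) ∈ S) (h' : (a', b, i') ∈ S) : a = a' ∧ i = i' := by
  simpa using hS.injOn_woman h h' rfl

/-- An edge that is not in a stable matching is dominated at its man or at its woman. -/
theorem IsLevelStable.dominated' {T : Set (A × B × ℕ)} (hS : I.IsLevelStable T S)
    {a : A} {b : B} {i : ℕ} (hf : (a, b, i) ∈ T) (hfS : (a, b, i) ∉ S) :
    (∃ b' i', (a, b', i') ∈ S ∧ (i' < i ∨ i' = i ∧ I.manRank a b' < I.manRank a b)) ∨
    (∃ a' i', (a', b, i') ∈ S ∧ (i < i' ∨ i' = i ∧ I.womanRank b a' < I.womanRank b a)) := by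
  obtain ⟨⟨a', b', i'⟩, hg, h | h⟩ := hS.dominated _ hf hfS
  · obtain ⟨h1, h2⟩ := manBetter_iff.1 h
    obtain rfl : a' = a := h1
    exact .inl ⟨b', i', hg, h2⟩
  · obtain ⟨h1, h2⟩ := womanBetter_iff.1 h
    obtain rfl : b' = b := h1
    exact .inr ⟨a', i', hg, h2⟩

variable [Fintype A] [Fintype B]

open Classical in
/-- The edges of the original graph that occur in `S` at some level. -/
noncomputable def underlying (S : Set (A × B × ℕ)) : Finset (A × B) :=
  Finset.univ.filter fun e => ∃ i, (e.1, e.2, i) ∈ S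

theorem mem_underlying {a : A} {b : B} : (a, b) ∈ underlying S ↔ ∃ i, (a, b, i) ∈ S := by
  simp [underlying]

theorem IsLevelStable.isMatching (hS : I.IsLevelStable (I.levelEdges C c K) S) :
    I.IsMatching (underlying S) := by
  refine ⟨fun e he => ?_, ?_, ?_⟩
  · obtain ⟨i, hi⟩ := mem_underlying.1 he
    exact (hS.subset hi).1
  · rintro ⟨a, b⟩ he ⟨a', b'⟩ hf rfl
    obtain ⟨i, hi⟩ := mem_underlying.1 he
    obtain ⟨j, hj⟩ := mem_underlying.1 hf
    rw [(IsLevelStable.eq_of_man hS hi hj).1]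
  · rintro ⟨a, b⟩ he ⟨a', b'⟩ hf rfl
    obtain ⟨i, hi⟩ := mem_underlying.1 he
    obtain ⟨j, hj⟩ := mem_underlying.1 hf
    rw [(IsLevelStable.eq_of_woman hS hi hj).1]

/-- If there are enough levels, then a stable matching matches all critical men unless no matching
does. -/
theorem IsLevelStable.isFeasible (hS : I.IsLevelStable (I.levelEdges C c K) S)
    (hK : Fintype.card A + c ≤ K) {N : Finset (A × B)} (hN : I.IsFeasible C N) :
    I.IsFeasible C (underlying S) := by
  classical
  refine ⟨IsLevelStable.isMatching hS, fun a₀ ha₀ => ?_⟩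
  by_contra! hfree
  have hfree' : ∀ b i, (a₀, b, i) ∉ S := fun b i h => hfree b (mem_underlying.2 ⟨i, h⟩)
  let lv : A → ℕ := fun a => if h : ∃ i b, (a, b, i) ∈ S then h.choose else 0
  have lv_eq {a b i} (h : (a, b, i) ∈ S) : lv a = i := by
    have hex : ∃ i b, (a, b, i) ∈ S := ⟨i, b, h⟩
    simp only [lv, dif_pos hex]
    obtain ⟨b', hb'⟩ := hex.choose_spec
    exact (IsLevelStable.eq_of_man hS hb' h).2
  -- There are at least `|A|` levels above `c`, and the men other than the unmatched `a₀` occupy at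
  -- most `|A| - 1` of them, so some level above `c` is empty.
  obtain ⟨l, hl, hgap⟩ : ∃ l ∈ Finset.Ioc c K, l ∉ (Finset.univ.erase a₀).image lv := by
    refine Finset.exists_mem_notMem_of_card_lt_card (lt_of_le_of_lt Finset.card_image_le ?_)
    rw [Finset.card_erase_of_mem (Finset.mem_univ _), Finset.card_univ, Nat.card_Ioc]
    have : 0 < Fintype.card A := Fintype.card_pos_iff.2 ⟨a₀⟩
    lia
  rw [Finset.mem_Ioc] at hl
  have hne {a b i} (h : (a, b, i) ∈ S) : i ≠ l := fun hi => hgap (Finset.mem_image.2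
    ⟨a, Finset.mem_erase.2 ⟨fun ha => hfree' b i (ha ▸ h), Finset.mem_univ _⟩,
      (lv_eq h).trans hi⟩)
  -- Everyone in `X` is critical because `l > c`, so `N` gives him a partner. The copy of that edge
  -- at level `l` is not dominated at the man, hence the woman is matched in `S` at a level above
  -- `l`, to a man in `X` other than `a₀`. This injects `X` into `X.erase a₀`, which is absurd.
  let X : Finset A := Finset.univ.filter fun a => a = a₀ ∨ ∃ b i, (a, b, i) ∈ S ∧ l < i
  have hX : ∀ a ∈ X, ∃ a' ∈ X.erase a₀, ∃ b i, (a, b) ∈ N ∧ (a', b, i) ∈ S := by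
    intro a ha
    have ha' : a = a₀ ∨ ∃ b i, (a, b, i) ∈ S ∧ l < i := by simpa [X] using ha
    have haC : a ∈ C := by
      rcases ha' with rfl | ⟨b, i, h, hi⟩
      · exact ha₀
      · by_contra haC
        exact absurd ((hS.subset h).2.2 haC) (by simp only; lia)
    obtain ⟨b, hb⟩ := hN.2 a haC
    have he : (a, b, l) ∈ I.levelEdges C c K :=
      ⟨hN.1.1 _ hb, fun _ => hl.2, fun h => absurd haC h⟩
    rcases IsLevelStable.dominated' hS he fun h => hne h rfl with
      ⟨b', i', h, hi⟩ | ⟨a', i', h, hi⟩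
    · rcases ha' with rfl | ⟨b'', i, h', hi'⟩
      · exact absurd h (hfree' _ _)
      · have := (IsLevelStable.eq_of_man hS h h').2
        lia
    · have := hne h
      refine ⟨a', Finset.mem_erase.2 ⟨?_, ?_⟩, b, i', hb, h⟩
      · rintro rfl
        exact hfree' _ _ h
      · simp only [X, Finset.mem_filter, Finset.mem_univ, true_and]
        exact .inr ⟨b, i', h, by lia⟩
  choose! h hh using hX
  have hinj : Set.InjOn h X := by
    intro a₁ h₁ a₂ h₂ heq
    obtain ⟨-, b₁, i₁, hb₁, hs₁⟩ := hh a₁ h₁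
    obtain ⟨-, b₂, i₂, hb₂, hs₂⟩ := hh a₂ h₂
    rw [heq] at hs₁
    obtain rfl := (IsLevelStable.eq_of_man hS hs₁ hs₂).1
    exact hN.1.left_unique hb₁ hb₂
  have hcard := Finset.card_le_card_of_injOn h (fun a ha => (hh a ha).1) hinj
  have : a₀ ∈ X := by simp [X]
  exact absurd hcard (Finset.card_erase_lt_of_mem this).not_ge

open Classical in
/-- A stable matching of the multigraph yields a dual certificate. -/
theorem IsLevelStable.exists_isWitness (hS : I.IsLevelStable (I.levelEdges C c K) S)
    (hc : c ≤ 1) (hcK : c ≤ K) (hM : I.IsFeasible C (underlying S)) :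
    ∃ y z, I.IsWitness C (underlying S) y z ∧ (∀ a b i, (a, b, i) ∈ S → y a = c - 2 * i) ∧
      ∀ a, (∀ b i, (a, b, i) ∉ S) → y a = 0 := by
  let y : A → ℤ := fun a => if h : ∃ i b, (a, b, i) ∈ S then c - 2 * h.choose else 0
  let z : B → ℤ := fun b => if h : ∃ i a, (a, b, i) ∈ S then 2 * h.choose - c else 0
  have hy {a b i} (h : (a, b, i) ∈ S) : y a = c - 2 * i := by
    have hex : ∃ i b, (a, b, i) ∈ S := ⟨i, b, h⟩
    simp only [y, dif_pos hex]
    obtain ⟨b', hb'⟩ := hex.choose_spec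
    rw [(IsLevelStable.eq_of_man hS hb' h).2]
  have hz {a b i} (h : (a, b, i) ∈ S) : z b = 2 * i - c := by
    have hex : ∃ i a, (a, b, i) ∈ S := ⟨i, a, h⟩
    simp only [z, dif_pos hex]
    obtain ⟨a', ha'⟩ := hex.choose_spec
    rw [(IsLevelStable.eq_of_woman hS ha' h).2]
  have hy0 {a} (h : ∀ b i, (a, b, i) ∉ S) : y a = 0 := dif_neg fun ⟨i, b, h'⟩ => h b i h'
  have hz0 {b} (h : ∀ a i, (a, b, i) ∉ S) : z b = 0 := dif_neg fun ⟨i, a, h'⟩ => h a i h'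
  have free_man {a} (h : ∀ b, (a, b) ∉ underlying S) (b i) : (a, b, i) ∉ S :=
    fun h' => h b (mem_underlying.2 ⟨i, h'⟩)
  have free_woman {b} (h : ∀ a, (a, b) ∉ underlying S) (a i) : (a, b, i) ∉ S :=
    fun h' => h a (mem_underlying.2 ⟨i, h'⟩)
  have hp1 (a b) : I.manVote (underlying S) a b ≤ 1 := vote_le_one
  have hq1 (a b) : I.womanVote (underlying S) b a ≤ 1 := vote_le_one
  have hp {a b b' : _} {i' : ℕ} (h : (a, b', i') ∈ S) (hr : I.manRank a b' < I.manRank a b) :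
      I.manVote (underlying S) a b = -1 :=
    vote_of_gt (fun u hu => hM.1.right_unique hu (mem_underlying.2 ⟨i', h⟩))
      (mem_underlying.2 ⟨i', h⟩) hr
  have hq {a a' b : _} {i' : ℕ} (h : (a', b, i') ∈ S) (hr : I.womanRank b a' < I.womanRank b a) :
      I.womanVote (underlying S) b a = -1 :=
    vote_of_gt (fun u hu => hM.1.left_unique hu (mem_underlying.2 ⟨i', h⟩))
      (mem_underlying.2 ⟨i', h⟩) hr
  refine ⟨y, z, ⟨fun a b hab => ?_, fun a b hab => ?_, fun a ha => hy0 (free_man ha),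
    fun b hb => hz0 (free_woman hb), fun a ha => ?_, fun b => ?_⟩, fun a b i => hy,
    fun a => hy0⟩
  · have p1 := hp1 a b
    have q1 := hq1 a b
    by_cases hab' : (a, b) ∈ underlying S
    · obtain ⟨i, hi⟩ := mem_underlying.1 hab'
      have e1 : I.manVote (underlying S) a b = 0 := vote_self hab'
      have e2 : I.womanVote (underlying S) b a = 0 := vote_self hab'
      rw [e1, e2, hy hi, hz hi]
      lia
    have hnot (i) : (a, b, i) ∉ S := fun h => hab' (mem_underlying.2 ⟨i, h⟩)
    by_cases ha : ∃ b₁ k, (a, b₁, k) ∈ S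
    · obtain ⟨b₁, k, hk⟩ := ha
      have hlev (i) (hi : i ≤ k) : (a, b, i) ∈ I.levelEdges C c K :=
        ⟨hab, fun h => hi.trans ((hS.subset hk).2.1 h), fun h => hi.trans ((hS.subset hk).2.2 h)⟩
      have dom (i) (hi : i ≤ k) : (k = i ∧ I.manVote (underlying S) a b = -1) ∨
          ∃ a' i', (a', b, i') ∈ S ∧ (i < i' ∨ i' = i ∧ I.womanVote (underlying S) b a = -1) := by
        rcases IsLevelStable.dominated' hS (hlev i hi) (hnot i) with
          ⟨b', i', h, hd⟩ | ⟨a', i', h, hd⟩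
        · obtain ⟨rfl, rfl⟩ := IsLevelStable.eq_of_man hS h hk
          exact .inl (hd.elim (fun h => by lia) fun hd => ⟨hd.1, hp hk hd.2⟩)
        · exact .inr ⟨a', i', h, hd.imp_right fun hd => ⟨hd.1, hq h hd.2⟩⟩
      by_cases hb : ∃ a₁ j, (a₁, b, j) ∈ S
      · obtain ⟨a₁, j, hj⟩ := hb
        rw [hy hk, hz hj]
        have dom' (i) (hi : i ≤ k) : (k = i ∧ I.manVote (underlying S) a b = -1) ∨
            i < j ∨ j = i ∧ I.womanVote (underlying S) b a = -1 := by
          rcases dom i hi with h | ⟨a', i', h, hd⟩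
          · exact .inl h
          · rw [(IsLevelStable.eq_of_woman hS h hj).2] at hd
            exact .inr hd
        have d1 := dom' k le_rfl
        have d2 := dom' (k - 1) (by lia)
        lia
      · have hb' : ∀ a i, (a, b, i) ∉ S := fun a i h => hb ⟨a, i, h⟩
        rw [hy hk, hz0 hb']
        -- The woman is free, so the copy at level 0 is dominated at the man. This needs `k = 0` and
        -- his vote -1.
        rcases dom 0 (by lia) with h | ⟨a', i', h, -⟩
        · lia
        · exact absurd h (hb' _ _)
    · have ha' : ∀ b i, (a, b, i) ∉ S := fun b i h => ha ⟨b, i, h⟩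
      have haC : a ∉ C := fun hC => by
        obtain ⟨b, hb⟩ := hM.2 a hC
        obtain ⟨i, hi⟩ := mem_underlying.1 hb
        exact ha' _ _ hi
      -- A free man is not critical, so `c` is the top level of his edges and the copy that women
      -- like best.
      rcases IsLevelStable.dominated' hS (i := c) ⟨hab, fun h => absurd h haC, fun _ => le_rfl⟩
        (hnot c) with ⟨b', i', h, -⟩ | ⟨a', i', h, hd⟩
      · exact absurd h (ha' _ _)
      · rw [hy0 ha', hz h]
        rcases hd with hd | ⟨rfl, hd⟩
        · lia
        · have := hq h hd
          lia
  · obtain ⟨i, hi⟩ := mem_underlying.1 hab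
    rw [hy hi, hz hi]
    lia
  · by_cases h : ∃ b i, (a, b, i) ∈ S
    · obtain ⟨b, i, h⟩ := h
      have := (hS.subset h).2.2 ha
      simp only at this
      rw [hy h]
      lia
    · rw [hy0 fun b i h' => h ⟨b, i, h'⟩]
      lia
  · by_cases h : ∃ a i, (a, b, i) ∈ S
    · obtain ⟨a, i, h⟩ := h
      rw [hz h]
      lia
    · rw [hz0 fun a i h' => h ⟨a, i, h'⟩]
      lia

end StableToPopular

end MarriageInstance

namespace MarriageInstance

variable {A B : Type*} [DecidableEq A] [DecidableEq B] {I : MarriageInstance A B}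
  {C : Set A} {c K : ℕ} {S : Set (A × B × ℕ)} {M : Finset (A × B)} {y : A → ℤ} {z : B → ℤ}

/-! ### From certificates to stable matchings -/

section PopularToStable

variable (I) in
/-- The levelled edges that are at least as good for both endpoints as a certificate `(y, z)` for
the matching `M` demands. -/
def demandedEdges (C : Set A) (c K : ℕ) (M : Finset (A × B)) (y : A → ℤ) (z : B → ℤ) :
    Set (A × B × ℕ) :=
  {f | f ∈ I.levelEdges C c K ∧
    ((f.2.2 : ℤ) < -((y f.1 - c) / 2) ∨
      (f.2.2 : ℤ) = -((y f.1 - c) / 2) ∧ 0 ≤ I.manVote M f.1 f.2.1) ∧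
    ((z f.2.1 + c) / 2 < (f.2.2 : ℤ) ∨
      (z f.2.1 + c) / 2 = (f.2.2 : ℤ) ∧ 0 ≤ I.womanVote M f.2.1 f.1)}

theorem manVote_cases (a : A) (b : B) :
    (I.manVote M a b = 0 ∧ I.womanVote M b a = 0) ∨
      ((I.manVote M a b = -1 ∨ I.manVote M a b = 1) ∧
        (I.womanVote M b a = -1 ∨ I.womanVote M b a = 1)) := by
  by_cases h : (a, b) ∈ M
  · exact .inl ⟨vote_self h, vote_self h⟩
  · exact .inr ⟨vote_of_not h, vote_of_not h⟩

theorem mem_of_manVote_eq_zero {a : A} {b : B} (h : I.manVote M a b = 0) : (a, b) ∈ M :=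
  (vote_eq_zero_iff (P := fun b => (a, b) ∈ M)).1 h

/-- Every stable matching of the demanded edges is stable in the whole multigraph, and contains
the edges of `M` whose certificate has the parity of `c`. -/
theorem IsWitness.isLevelStable (h : I.IsWitness C M y z) (hM : I.IsFeasible C M) (hc : c ≤ 1)
    (hK : ∀ a, -(2 * K : ℤ) + 1 ≤ y a)
    (hS : I.IsLevelStable (I.demandedEdges C c K M y z) S) :
    I.IsLevelStable (I.levelEdges C c K) S ∧
      ∀ a b, (a, b) ∈ M → Even (y a - c) → ∃ i, (a, b, i) ∈ S := by
  have hsub : S ⊆ I.levelEdges C c K := fun f hf => (hS.subset hf).1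
  have votes_mem {a b} (hab : (a, b) ∈ M) : I.manVote M a b = 0 ∧ I.womanVote M b a = 0 :=
    ⟨vote_self hab, vote_self hab⟩
  -- On an edge of `M` we have `z b = -y a`, so the man's threshold is `(c - y a) / 2` rounded up
  -- and the woman's is the same number rounded down. They agree exactly if `y a` has the parity of
  -- `c`.
  have lev {a b} (hab : (a, b) ∈ M) {i : ℕ} (hi : (i : ℤ) ≤ -((y a - c) / 2))
      (hi' : (i : ℤ) ≤ (z b + c) / 2 ∨ (a ∉ C → i ≤ c) ∧ (a ∈ C → i ≤ K)) :
      (a, b, i) ∈ I.levelEdges C c K := by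
    have h1 := h.tight a b hab
    have h2 := hK a
    refine ⟨hM.1.1 _ hab, fun hC => ?_, fun hC => ?_⟩
    · simp only
      lia
    · simp only
      have h3 := h.neg_one_le_man a hC
      rcases hi' with hi' | hi'
      · lia
      · exact hi'.1 hC
  have dem {a b} {i : ℕ} (hf : (a, b, i) ∈ S) := hS.subset hf
  refine ⟨⟨hsub, hS.injOn_man, hS.injOn_woman, ?_⟩, ?_⟩
  · rintro ⟨a, b, i⟩ hf hfS
    by_cases hT : (a, b, i) ∈ I.demandedEdges C c K M y z
    · exact hS.dominated _ hT hfS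
    by_cases hman : (i : ℤ) < -((y a - c) / 2) ∨
        (i : ℤ) = -((y a - c) / 2) ∧ 0 ≤ I.manVote M a b
    · have hwoman : ¬ ((z b + c) / 2 < (i : ℤ) ∨
          (z b + c) / 2 = (i : ℤ) ∧ 0 ≤ I.womanVote M b a) := fun hw => hT ⟨hf, hman, hw⟩
      -- A free woman has `z b = 0` and threshold 0, and she votes 1 for every man, so every edge
      -- meets her standard.
      have hbM : ∃ a₀, (a₀, b) ∈ M := by
        by_contra! hfree
        have h0 := h.woman_free b hfree
        have : I.womanVote M b a = 1 := vote_of_free hfree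
        lia
      obtain ⟨a₀, hab⟩ := hbM
      obtain ⟨k, hk⟩ : ∃ k : ℕ, (k : ℤ) = (z b + c) / 2 := ⟨((z b + c) / 2).toNat, by lia⟩
      have ht := h.tight _ _ hab
      have hv := votes_mem hab
      have hf₁ : (a₀, b, k) ∈ I.demandedEdges C c K M y z := by
        refine ⟨lev hab (by lia) (.inl hk.le), ?_, .inr ⟨hk.symm, hv.2.ge⟩⟩
        simp only
        lia
      obtain ⟨a₂, k₂, hs⟩ : ∃ a₂ k₂, (a₂, b, k₂) ∈ S := by
        by_cases hmem : (a₀, b, k) ∈ S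
        · exact ⟨_, _, hmem⟩
        rcases IsLevelStable.dominated' hS hf₁ hmem with ⟨b', i', hg, hlt⟩ | ⟨a', i', hg, -⟩
        · exfalso
          -- A demanded edge that `a₀` likes better than `(a₀, b, k)` contradicts the certificate.
          -- The two votes of an edge always have an even sum, so the rounding of the thresholds
          -- leaves no room. Thus `S` has an edge at `b`; it meets the standard of `b`, which the
          -- given edge fails, and so `b` prefers it.
          obtain ⟨⟨hedge, -⟩, h1, h2⟩ := dem hg
          have h3 := h.edge _ _ hedge
          simp only at h1 h2 h3
          have hlt' : i' < k ∨ i' = k ∧ I.manVote M a₀ b' = 1 :=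
            hlt.imp_right fun h' => ⟨h'.1, vote_of_lt (fun u hu => hM.1.right_unique hu hab) h'.2⟩
          have h4 := I.manVote_cases (M := M) a₀ b'
          lia
        · exact ⟨_, _, hg⟩
      refine ⟨_, hs, .inr (womanBetter_iff.2 ⟨rfl, ?_⟩)⟩
      obtain ⟨⟨hedge, -⟩, -, h2⟩ := dem hs
      simp only at h2 ⊢
      rcases vote_cases (rank := I.womanRank b) (P := fun a => (a, b) ∈ M) (x := a) with
        hq | hq | hq
      · have := hq.symm.le
        change 0 ≤ I.womanVote M b a at this
        lia
      · have hlt := rank_lt_of_vote_eq_neg_one (fun u hu => hM.1.left_unique hu hab) hq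
        have hle : 0 ≤ I.womanVote M b a₂ → I.womanRank b a₂ ≤ I.womanRank b a₀ := fun h' => by
          rcases vote_cases (rank := I.womanRank b) (P := fun a => (a, b) ∈ M) (x := a₂) with
            hq' | hq' | hq'
          · rw [hM.1.left_unique ((vote_eq_zero_iff (P := fun a => (a, b) ∈ M)).1 hq') hab]
          · change I.womanVote M b a₂ = -1 at hq'
            lia
          · exact (rank_lt_of_vote_eq_one (fun he => (I.womanRank_inj hedge).1 he) hab hq').le
        lia
      · change I.womanVote M b a = 1 at hq
        lia
    -- A free man has `y a = 0` and threshold `c`, the top level of a man who is not critical, so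
    -- every edge meets his standard.
    · have haM : ∃ b₀, (a, b₀) ∈ M := by
        by_contra! hfree
        have h0 := h.man_free a hfree
        have : I.manVote M a b = 1 := vote_of_free hfree
        have := hf.2.2 fun hC => (hM.2 a hC).elim hfree
        simp only at this
        lia
      obtain ⟨b₀, hab⟩ := haM
      have ht := h.tight _ _ hab
      have hz := h.neg_one_le_woman b₀
      obtain ⟨k, hk⟩ : ∃ k : ℕ, (k : ℤ) = -((y a - c) / 2) := ⟨(-((y a - c) / 2)).toNat, by lia⟩
      have hv := votes_mem hab
      have hki : k ≤ i := by lia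
      have hf₁ : (a, b₀, k) ∈ I.demandedEdges C c K M y z := by
        refine ⟨lev hab hk.le (.inr ⟨fun hC => hki.trans (hf.2.2 hC), fun hC =>
          hki.trans (hf.2.1 hC)⟩), .inr ⟨hk, hv.1.ge⟩, ?_⟩
        simp only
        lia
      obtain ⟨b₂, k₂, hs⟩ : ∃ b₂ k₂, (a, b₂, k₂) ∈ S := by
        by_cases hmem : (a, b₀, k) ∈ S
        · exact ⟨_, _, hmem⟩
        rcases IsLevelStable.dominated' hS hf₁ hmem with ⟨b', i', hg, -⟩ | ⟨a', i', hg, hlt⟩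
        · exact ⟨_, _, hg⟩
        · exfalso
          obtain ⟨⟨hedge, -⟩, h1, h2⟩ := dem hg
          have h3 := h.edge _ _ hedge
          simp only at h1 h2 h3
          have hlt' : k < i' ∨ i' = k ∧ I.womanVote M b₀ a' = 1 :=
            hlt.imp_right fun h' => ⟨h'.1, vote_of_lt (fun u hu => hM.1.left_unique hu hab) h'.2⟩
          have h4 := I.manVote_cases (M := M) a' b₀
          lia
      refine ⟨_, hs, .inl (manBetter_iff.2 ⟨rfl, ?_⟩)⟩
      obtain ⟨⟨hedge, -⟩, h2, -⟩ := dem hs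
      simp only at h2 ⊢
      rcases vote_cases (rank := I.manRank a) (P := fun b => (a, b) ∈ M) (x := b) with
        hq | hq | hq
      · have := hq.symm.le
        change 0 ≤ I.manVote M a b at this
        lia
      · have hlt := rank_lt_of_vote_eq_neg_one (fun u hu => hM.1.right_unique hu hab) hq
        have hle : 0 ≤ I.manVote M a b₂ → I.manRank a b₂ ≤ I.manRank a b₀ := fun h' => by
          rcases vote_cases (rank := I.manRank a) (P := fun b => (a, b) ∈ M) (x := b₂) with
            hq' | hq' | hq'
          · rw [hM.1.right_unique ((vote_eq_zero_iff (P := fun b => (a, b) ∈ M)).1 hq') hab]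
          · change I.manVote M a b₂ = -1 at hq'
            lia
          · exact (rank_lt_of_vote_eq_one (fun he => (I.manRank_inj hedge).1 he) hab hq').le
        lia
      · change I.manVote M a b = 1 at hq
        lia
  · rintro a b hab ⟨r, hr⟩
    have ht := h.tight _ _ hab
    have hz := h.neg_one_le_woman b
    obtain ⟨k, hk⟩ : ∃ k : ℕ, (k : ℤ) = -((y a - c) / 2) := ⟨(-((y a - c) / 2)).toNat, by lia⟩
    have hv := votes_mem hab
    refine ⟨k, ?_⟩
    by_contra hmem
    have hf₁ : (a, b, k) ∈ I.demandedEdges C c K M y z := by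
      refine ⟨lev hab hk.le (.inl (by lia)), .inr ⟨hk, hv.1.ge⟩, .inr ⟨?_, hv.2.ge⟩⟩
      simp only
      lia
    rcases IsLevelStable.dominated' hS hf₁ hmem with ⟨b', i', hg, hlt⟩ | ⟨a', i', hg, hlt⟩
    · obtain ⟨⟨hedge, -⟩, h1, h2⟩ := dem hg
      have h3 := h.edge _ _ hedge
      simp only at h1 h2 h3
      have h4 := I.manVote_cases (M := M) a b'
      -- With equal thresholds at `(a, b)` the certificate leaves a dominating demanded edge only
      -- the votes 0, so it would be the same edge of `M` at the same level. The woman's side below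
      -- is symmetric.
      have h5 : I.manVote M a b' = 0 := by lia
      obtain rfl := hM.1.right_unique hab (mem_of_manVote_eq_zero h5)
      have : i' = k := by lia
      lia
    · obtain ⟨⟨hedge, -⟩, h1, h2⟩ := dem hg
      have h3 := h.edge _ _ hedge
      simp only at h1 h2 h3
      have h4 := I.manVote_cases (M := M) a' b
      have h5 : I.manVote M a' b = 0 := by lia
      obtain rfl := hM.1.left_unique hab (mem_of_manVote_eq_zero h5)
      have : i' = k := by lia
      lia

end PopularToStable

/-! ### The characterization of the popular feasible edges -/

section Characterization

variable [Fintype A] [Fintype B]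

/-- The edges of a popular feasible matching are split by the parity of its certificate: each of
them is a stable edge of the multigraph for `c = 0` or of the one for `c = 1`. -/
theorem IsPopularFeasible.exists_isLevelStable (hM : I.IsPopularFeasible C M) {a : A} {b : B}
    (hab : (a, b) ∈ M) (hK : Fintype.card A + Fintype.card B + 1 ≤ K) :
    ∃ c ≤ 1, ∃ S, I.IsLevelStable (I.levelEdges C c K) S ∧ ∃ i, (a, b, i) ∈ S := by
  obtain ⟨y, z, hw, hbound⟩ := hM.exists_isWitness
  obtain ⟨c, hc, hpar⟩ : ∃ c : ℕ, c ≤ 1 ∧ Even (y a - c) := by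
    rcases Int.even_or_odd (y a) with he | ho
    · exact ⟨0, zero_le_one, by simpa using he⟩
    · exact ⟨1, le_rfl, ho.sub_odd (by simp)⟩
  obtain ⟨S, hS⟩ := exists_isStableIn I.isStarOrder_manBetter I.isStarOrder_womanBetter
    (T := I.demandedEdges C c K M y z) ((finite_levelEdges C c K).subset fun f hf => hf.1)
    fun f hf => hf.1.1
  obtain ⟨h1, h2⟩ := hw.isLevelStable hM.1 hc (fun a => by have := hbound a; lia) hS
  exact ⟨c, hc, S, h1, h2 a b hab hpar⟩

theorem IsLevelStable.isPopularFeasible (hS : I.IsLevelStable (I.levelEdges C c K) S)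
    (hc : c ≤ 1) (hcK : c ≤ K) (hM : I.IsFeasible C (underlying S)) :
    I.IsPopularFeasible C (underlying S) := by
  obtain ⟨y, z, hw, -⟩ := IsLevelStable.exists_isWitness hS hc hcK hM
  exact hw.isPopularFeasible hM

/-- The potentials `c - 2 * i` of the matched men have the parity of `c`. For `c = 0` all potentials
are even, as free men have 0; for `c = 1` those of the matched men are odd. -/
theorem IsLevelStable.isMinSize_or_isDominant (hS : I.IsLevelStable (I.levelEdges C c K) S)
    (hc : c ≤ 1) (hcK : c ≤ K) (hM : I.IsFeasible C (underlying S)) :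
    I.IsMinSizePopularFeasible C (underlying S) ∨ I.IsDominantFeasible C (underlying S) := by
  obtain ⟨y, z, hw, hy, hy0⟩ := IsLevelStable.exists_isWitness hS hc hcK hM
  obtain rfl | rfl : c = 0 ∨ c = 1 := by lia
  · refine .inl (hw.isMinSizePopularFeasible hM fun a => ?_)
    by_cases h : ∃ b i, (a, b, i) ∈ S
    · obtain ⟨b, i, h⟩ := h
      rw [hy a b i h]
      exact ⟨-i, by lia⟩
    · rw [hy0 a fun b i h' => h ⟨b, i, h'⟩]
      exact ⟨0, rfl⟩
  · refine .inr (hw.isDominantFeasible hM fun a b hab => ?_)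
    obtain ⟨i, h⟩ := mem_underlying.1 hab
    rw [hy a b i h]
    exact ⟨-i, by lia⟩

theorem exists_isPopularFeasible_iff (C : Set A) (e : A × B) :
    (∃ M, I.IsPopularFeasible C M ∧ e ∈ M) ↔
      ((∃ M, I.IsMinSizePopularFeasible C M ∧ e ∈ M) ∨
        (∃ M, I.IsDominantFeasible C M ∧ e ∈ M)) := by
  refine ⟨fun ⟨M, hM, he⟩ => ?_, ?_⟩
  · obtain ⟨c, hc, S, hS, i, hi⟩ := hM.exists_isLevelStable he le_rfl
    have hfeas := IsLevelStable.isFeasible hS (by lia) hM.1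
    exact (IsLevelStable.isMinSize_or_isDominant hS hc (by lia) hfeas).imp
      (fun h => ⟨_, h, mem_underlying.2 ⟨i, hi⟩⟩) fun h => ⟨_, h, mem_underlying.2 ⟨i, hi⟩⟩
  · rintro (⟨M, hM, he⟩ | ⟨M, hM, he⟩)
    · exact ⟨M, hM.1, he⟩
    · exact ⟨M, hM.1, he⟩

end Characterization

end MarriageInstance

/-! ### Polynomial-time computable functions -/

theorem Polynomial.eval_le_eval_of_le (P : Polynomial ℕ) {a b : ℕ} (h : a ≤ b) :
    P.eval a ≤ P.eval b := by
  induction P using Polynomial.induction_on' with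
  | add p q hp hq => simpa using add_le_add hp hq
  | monomial n c => simpa using Nat.mul_le_mul_left c (Nat.pow_le_pow_left h n)

namespace Data

@[simp] theorem size_nil : size .nil = 1 := rfl

@[simp] theorem size_node (y z : Data) : size (.node () y z) = y.size + z.size := by
  simp only [size, BinaryTree.numNodes]; lia

theorem size_pos (x : Data) : 0 < x.size := Nat.succ_pos _

theorem ofBool_injective : Function.Injective ofBool := by
  intro a b h
  cases a <;> cases b <;> simp_all [ofBool]

theorem ofList_injective : Function.Injective ofList := by
  intro l
  induction l with
  | nil => intro l' h; cases l' <;> simp_all [ofList]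
  | cons x l ih =>
    intro l' h
    cases l' with
    | nil => simp [ofList] at h
    | cons x' l' =>
      simp only [ofList, BinaryTree.node.injEq, true_and] at h
      rw [h.1, ih h.2]

theorem ofNat_injective : Function.Injective ofNat := fun _ _ h => by
  simpa using congrArg List.length (ofList_injective h)

@[simp] theorem size_ofList_cons (x : Data) (l : List Data) :
    (ofList (x :: l)).size = x.size + (ofList l).size := by simp [ofList]

@[simp] theorem size_ofNat (k : ℕ) : (ofNat k).size = k + 1 := by
  induction k with
  | zero => rfl
  | succ k ih =>
    rw [ofNat, List.replicate_succ, size_ofList_cons, ← ofNat, ih]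
    simp; lia

end Data

/-- Time bounds are thereby also bounds on output sizes, which is what makes polynomial time closed
under composition. -/
theorem Code.Runs.size_le {p : Code} {x y : Data} {t : ℕ} (h : p.Runs x y t) : y.size ≤ t := by
  induction h with
  | id | fst_nil | snd_nil | eq_nil => exact le_rfl
  | nil x => exact x.size_pos
  | fst_node | snd_node => simp
  | eq_diff y z _ => rw [Data.size_node, Data.size_nil]; have := y.size_pos; lia
  | eq_same y => simp only [Data.size_node, Data.size_nil]; have := y.size_pos; lia
  | pair => rw [Data.size_node]; lia
  | _ => lia

/-- Some program maps `i k` to `o k`, for every `k`, in polynomial time. -/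
def PolyComp {ι : Type*} (i o : ι → Data) : Prop :=
  ∃ (p : Code) (P : Polynomial ℕ), ∀ k, ∃ t, p.Runs (i k) (o k) t ∧ t ≤ P.eval (i k).size

namespace PolyComp

variable {ι : Type*} {i o o' : ι → Data}

protected theorem id : PolyComp i i := ⟨.id, .X, fun k => ⟨_, .id _, by simp⟩⟩

theorem size_le (h : PolyComp i o) : ∃ P : Polynomial ℕ, ∀ k, (o k).size ≤ P.eval (i k).size := by
  obtain ⟨p, P, h⟩ := h
  refine ⟨P, fun k => ?_⟩
  obtain ⟨t, ht, hle⟩ := h k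
  exact ht.size_le.trans hle

theorem comp (h' : PolyComp o o') (h : PolyComp i o) : PolyComp i o' := by
  obtain ⟨p, P, h⟩ := h
  obtain ⟨q, Q, h'⟩ := h'
  refine ⟨.seq p q, P + Q.comp P + .X, fun k => ?_⟩
  obtain ⟨s, hs, hsP⟩ := h k
  obtain ⟨t, ht, htQ⟩ := h' k
  refine ⟨_, .seq hs ht, ?_⟩
  have := Q.eval_le_eval_of_le (hs.size_le.trans hsP)
  simp only [Polynomial.eval_add, Polynomial.eval_comp, Polynomial.eval_X]
  lia

theorem pair (h : PolyComp i o) (h' : PolyComp i o') :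
    PolyComp i fun k => .node () (o k) (o' k) := by
  obtain ⟨p, P, h⟩ := h
  obtain ⟨q, Q, h'⟩ := h'
  refine ⟨.pair p q, P + Q + .X, fun k => ?_⟩
  obtain ⟨s, hs, hsP⟩ := h k
  obtain ⟨t, ht, htQ⟩ := h' k
  refine ⟨_, .pair hs ht, ?_⟩
  simp only [Polynomial.eval_add, Polynomial.eval_X]
  lia

theorem fst (h : PolyComp i fun k => .node () (o k) (o' k)) : PolyComp i o :=
  comp ⟨.fst, .X, fun k => ⟨_, .fst_node _ _, by simp⟩⟩ h

theorem snd (h : PolyComp i fun k => .node () (o k) (o' k)) : PolyComp i o' :=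
  comp ⟨.snd, .X, fun k => ⟨_, .snd_node _ _, by simp⟩⟩ h

theorem const (d : Data) : PolyComp i fun _ => d := by
  induction d with
  | nil => exact ⟨.nil, .X, fun k => ⟨_, .nil _, by simp⟩⟩
  | node _ _ _ h h' => exact pair h h'

theorem ite {b : ι → Bool} (hb : PolyComp i fun k => Data.ofBool (b k)) (h : PolyComp i o)
    (h' : PolyComp i o') : PolyComp i fun k => if b k then o k else o' k := by
  obtain ⟨c, R, hb⟩ := hb
  obtain ⟨p, P, h⟩ := h
  obtain ⟨q, Q, h'⟩ := h'
  refine ⟨.ite c p q, R + P + Q + .X, fun k => ?_⟩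
  obtain ⟨r, hr, hrR⟩ := hb k
  obtain ⟨s, hs, hsP⟩ := h k
  obtain ⟨t, ht, htQ⟩ := h' k
  simp only [Polynomial.eval_add, Polynomial.eval_X]
  cases hk : b k with
  | true =>
    simp only [hk] at hr
    exact ⟨_, .ite_true hr (by simp [Data.ofBool]) (by simpa using hs), by lia⟩
  | false =>
    simp only [hk] at hr
    exact ⟨_, .ite_false hr (by simpa using ht), by lia⟩

theorem eq (h : PolyComp i o) (h' : PolyComp i o') [∀ k, Decidable (o k = o' k)] :
    PolyComp i fun k => Data.ofBool (decide (o k = o' k)) := by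
  refine comp ⟨.eq, .X, fun k => ?_⟩ (h.pair h')
  by_cases hk : o k = o' k
  · simp only [← hk]
    exact ⟨_, .eq_same _, by simp⟩
  · simp only [hk, decide_false]
    exact ⟨_, .eq_diff _ _ hk, by simp⟩

end PolyComp

/-! ### Encoded types and closure properties of polynomial time -/

/-- Types whose elements are represented by trees. -/
class TreeCode (α : Type*) where
  tree : α → Data
  tree_injective : Function.Injective tree

open TreeCode

namespace TreeCode

instance : TreeCode ℕ := ⟨Data.ofNat, Data.ofNat_injective⟩

instance : TreeCode Bool := ⟨Data.ofBool, Data.ofBool_injective⟩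

instance : TreeCode Unit := ⟨fun _ => .nil, fun _ _ _ => rfl⟩

instance {α β : Type*} [TreeCode α] [TreeCode β] : TreeCode (α × β) :=
  ⟨fun x => .node () (tree x.1) (tree x.2), fun x y h => by
    simp only [BinaryTree.node.injEq, true_and] at h
    exact Prod.ext (tree_injective h.1) (tree_injective h.2)⟩

instance {α : Type*} [TreeCode α] : TreeCode (List α) :=
  ⟨fun l => Data.ofList (l.map tree),
    Data.ofList_injective.comp (List.map_injective_iff.2 tree_injective)⟩

variable {α β : Type*} [TreeCode α] [TreeCode β]

/-- The size of the tree that represents `x`. -/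
def treeSize (x : α) : ℕ := (tree x).size

theorem treeSize_pos (x : α) : 0 < treeSize x := Data.size_pos _

@[simp] theorem treeSize_nat (k : ℕ) : treeSize k = k + 1 := Data.size_ofNat k

theorem treeSize_bool_le (b : Bool) : treeSize b ≤ 2 := by cases b <;> decide

@[simp] theorem treeSize_pair (x : α) (y : β) : treeSize (x, y) = treeSize x + treeSize y :=
  Data.size_node _ _

@[simp] theorem treeSize_cons (x : α) (l : List α) :
    treeSize (x :: l) = treeSize x + treeSize l := Data.size_ofList_cons _ _

theorem treeSize_list (l : List α) : treeSize l = (l.map treeSize).sum + 1 := by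
  induction l with
  | nil => rfl
  | cons x l ih => rw [treeSize_cons, ih, List.map_cons, List.sum_cons]; lia

theorem treeSize_append_left (l l' : List α) : treeSize l ≤ treeSize (l ++ l') := by
  simp [treeSize_list]

theorem treeSize_append_right (l l' : List α) : treeSize l' ≤ treeSize (l ++ l') := by
  simp [treeSize_list]

theorem treeSize_reverse (l : List α) : treeSize l.reverse = treeSize l := by
  simp [treeSize_list, List.sum_reverse]

theorem treeSize_of_sublist {l l' : List α} (h : l.Sublist l') : treeSize l ≤ treeSize l' := by
  rw [treeSize_list, treeSize_list]
  exact Nat.add_le_add_right ((h.map _).sum_le_sum fun _ _ => Nat.zero_le _) 1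

theorem length_lt_treeSize (l : List α) : l.length < treeSize l := by
  induction l with
  | nil => exact Nat.zero_lt_one
  | cons x l ih => rw [treeSize_cons, List.length_cons]; have := treeSize_pos x; lia

theorem treeSize_le_of_mem {l : List α} {x : α} (h : x ∈ l) : treeSize x ≤ treeSize l := by
  have := List.single_le_sum (l := l.map treeSize) (fun _ _ => Nat.zero_le _) _
    (List.mem_map_of_mem h)
  rw [treeSize_list l]
  lia

theorem treeSize_list_le {l : List α} {b : ℕ} (h : ∀ x ∈ l, treeSize x ≤ b) :
    treeSize l ≤ l.length * b + 1 := by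
  have := List.sum_le_card_nsmul (l.map treeSize) b (by simpa using h)
  rw [treeSize_list]
  simpa using this

/-- In unary a number and a list of units are the same tree, so arithmetic and bounded iteration
reduce to list processing. -/
theorem tree_replicate_unit (k : ℕ) : tree (List.replicate k ()) = tree k := by
  simp only [tree, List.map_replicate, Data.ofNat]

end TreeCode

/-- The function `f` is computed by some program in polynomial time. -/
def PolyTime {α β : Type*} [TreeCode α] [TreeCode β] (f : α → β) : Prop :=
  PolyComp (fun x : α => tree x) fun x => tree (f x)

namespace PolyTime

variable {γ α β σ : Type*} [TreeCode γ] [TreeCode α] [TreeCode β] [TreeCode σ]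

theorem exists_treeSize_le {f : α → β} (hf : PolyTime f) :
    ∃ P : Polynomial ℕ, ∀ x, treeSize (f x) ≤ P.eval (treeSize x) := hf.size_le

protected theorem id : PolyTime fun x : α => x := PolyComp.id

theorem comp {g : α → β} {f : γ → α} (hg : PolyTime g) (hf : PolyTime f) :
    PolyTime fun x => g (f x) := by
  obtain ⟨p, P, hg⟩ := hg
  exact PolyComp.comp ⟨p, P, fun k => hg (f k)⟩ hf

theorem const (b : β) : PolyTime fun _ : α => b := PolyComp.const _

theorem pair {f : γ → α} {g : γ → β} (hf : PolyTime f) (hg : PolyTime g) :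
    PolyTime fun x => (f x, g x) := PolyComp.pair hf hg

theorem fst {f : γ → α × β} (hf : PolyTime f) : PolyTime fun x => (f x).1 := PolyComp.fst hf

theorem snd {f : γ → α × β} (hf : PolyTime f) : PolyTime fun x => (f x).2 := PolyComp.snd hf

theorem comp₂ {h : α × β → σ} (hh : PolyTime h) {f : γ → α} {g : γ → β} (hf : PolyTime f)
    (hg : PolyTime g) : PolyTime fun x => h (f x, g x) := hh.comp (hf.pair hg)

theorem cons {f : γ → α} {g : γ → List α} (hf : PolyTime f) (hg : PolyTime g) :
    PolyTime fun x => f x :: g x := PolyComp.pair hf hg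

theorem succ {f : γ → ℕ} (hf : PolyTime f) : PolyTime fun x => f x + 1 :=
  PolyComp.pair (PolyComp.const .nil) hf

theorem pred {f : γ → ℕ} (hf : PolyTime f) : PolyTime fun x => f x - 1 := by
  refine PolyComp.comp (o := fun x => tree (f x)) ⟨.snd, .X, fun k => ?_⟩ hf
  simp only [Polynomial.eval_X]
  rcases f k with - | n
  · exact ⟨_, .snd_nil, le_rfl⟩
  · exact ⟨_, .snd_node .nil (Data.ofNat n), le_rfl⟩

theorem cond {b : γ → Bool} {f g : γ → α} (hb : PolyTime b) (hf : PolyTime f)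
    (hg : PolyTime g) : PolyTime fun x => bif b x then f x else g x := by
  have := PolyComp.ite hb hf hg
  unfold PolyTime
  convert this using 2 with x
  cases hb : b x <;> simp only [hb] <;> rfl

theorem and {f g : γ → Bool} (hf : PolyTime f) (hg : PolyTime g) :
    PolyTime fun x => f x && g x := by
  convert hf.cond hg (const false) using 2 with x
  cases f x <;> rfl

theorem or {f g : γ → Bool} (hf : PolyTime f) (hg : PolyTime g) :
    PolyTime fun x => f x || g x := by
  convert hf.cond (const true) hg using 2 with x
  cases f x <;> rfl

theorem not {f : γ → Bool} (hf : PolyTime f) : PolyTime fun x => !f x := by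
  convert hf.cond (const false) (const true) using 2 with x
  cases f x <;> rfl

theorem eq {f g : γ → α} [DecidableEq α] (hf : PolyTime f) (hg : PolyTime g) :
    PolyTime fun x => decide (f x = g x) := by
  classical
  have := PolyComp.eq hf hg
  simp only [(tree_injective (α := α)).eq_iff] at this
  unfold PolyTime
  convert this using 2
  exact congrArg Data.ofBool (decide_eq_decide.2 Iff.rfl)

/-- Folding a polynomial-time function over a list takes polynomial time if the intermediate results
have polynomial size. -/
theorem foldl {l : γ → List α} {s : γ → σ} {g : γ → σ → α → σ} (hl : PolyTime l)
    (hs : PolyTime s) (hg : PolyTime fun x : γ × α × σ => g x.1 x.2.2 x.2.1) (Q : Polynomial ℕ)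
    (hQ : ∀ c l₁ l₂, l c = l₁ ++ l₂ → treeSize (l₁.foldl (g c) (s c)) ≤ Q.eval (treeSize c)) :
    PolyTime fun c => (l c).foldl (g c) (s c) := by
  -- The loop state is the triple of the parameter, the remaining list and the accumulator. The loop
  -- runs while the remaining list is not `nil`.
  have hcond : PolyComp (fun x : γ × List α × σ => tree x) fun x => tree x.2.1 :=
    PolyComp.fst (o' := fun x : γ × List α × σ => tree x.2.2)
      (PolyComp.snd (o := fun x : γ × List α × σ => tree x.1) PolyComp.id)
  -- The body only ever meets nonempty remaining lists, so head and tail are plain projections.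
  -- `PolyComp` can express this because it speaks of a family of inputs.
  have hbody : PolyComp (fun x : γ × α × List α × σ => tree (x.1, x.2.1 :: x.2.2.1, x.2.2.2))
      fun x => tree (x.1, x.2.2.1, g x.1 x.2.2.2 x.2.1) := by
    have e := PolyComp.id (i := fun x : γ × α × List α × σ =>
      tree (x.1, x.2.1 :: x.2.2.1, x.2.2.2))
    have e1 : PolyComp (fun x : γ × α × List α × σ => tree (x.1, x.2.1 :: x.2.2.1, x.2.2.2))
      fun x => tree x.1 := PolyComp.fst e
    have e2 : PolyComp (fun x : γ × α × List α × σ => tree (x.1, x.2.1 :: x.2.2.1, x.2.2.2))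
      fun x => tree (x.2.1 :: x.2.2.1) := PolyComp.fst (PolyComp.snd e)
    have e3 : PolyComp (fun x : γ × α × List α × σ => tree (x.1, x.2.1 :: x.2.2.1, x.2.2.2))
      fun x => tree x.2.2.2 := PolyComp.snd (PolyComp.snd e)
    have e4 : PolyComp (fun x : γ × α × List α × σ => tree (x.1, x.2.1 :: x.2.2.1, x.2.2.2))
      fun x => tree x.2.1 := PolyComp.fst e2
    have e5 : PolyComp (fun x : γ × α × List α × σ => tree (x.1, x.2.1 :: x.2.2.1, x.2.2.2))
      fun x => tree x.2.2.1 := PolyComp.snd e2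
    refine e1.pair (e5.pair (PolyComp.comp ?_ (e1.pair (e4.pair e3))))
    obtain ⟨p, P, hg⟩ := hg
    exact ⟨p, P, fun k => hg (k.1, k.2.1, k.2.2.2)⟩
  obtain ⟨pc, Pc, hcond⟩ := hcond
  obtain ⟨pb, Pb, hbody⟩ := hbody
  -- If `B` bounds the size of every state that occurs, each round costs at most a fixed polynomial
  -- in `B`.
  have loop (c : γ) (B : ℕ) (l : List α) : ∀ s : σ,
      (∀ l₁ l₂, l = l₁ ++ l₂ → treeSize (c, l₂, l₁.foldl (g c) s) ≤ B) →
      ∃ t, (Code.loop pc pb).Runs (tree (c, l, s)) (tree (c, ([] : List α), l.foldl (g c) s)) t ∧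
        t ≤ (l.length + 1) * (Pc.eval B + Pb.eval B + B) := by
    induction l with
    | nil =>
      intro s hB
      have hB := hB [] [] rfl
      obtain ⟨t, ht, htP⟩ := hcond (c, [], s)
      refine ⟨_, Code.Runs.loop_stop ht, ?_⟩
      have := Pc.eval_le_eval_of_le hB
      simp only [treeSize, List.foldl_nil] at *
      simp only [List.length_nil, zero_add, one_mul]
      lia
    | cons a l ih =>
      intro s hB
      obtain ⟨u, hu, huB⟩ := ih (g c s a) fun l₁ l₂ h => hB (a :: l₁) l₂ (by rw [h]; rfl)
      have hB := hB [] (a :: l) rfl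
      obtain ⟨t, ht, htP⟩ := hcond (c, a :: l, s)
      obtain ⟨r, hr, hrP⟩ := hbody (c, a, l, s)
      refine ⟨_, .loop_step ht (by simp [tree, Data.ofList]) hr hu, ?_⟩
      have h1 := Pc.eval_le_eval_of_le hB
      have h2 := Pb.eval_le_eval_of_le hB
      simp only [treeSize, List.foldl_nil] at *
      rw [List.length_cons, add_mul (l.length + 1)]
      lia
  have hinit : PolyTime fun c => (c, l c, s c) := PolyTime.id.pair (hl.pair hs)
  refine PolyComp.snd (o := fun _ => .nil) (PolyComp.snd (o := fun c => tree c)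
    (PolyComp.comp (o := fun c => tree (c, l c, s c)) ⟨.loop pc pb,
      -- With `X` the size of the initial state, there are fewer than `X` list entries, and every
      -- state has size at most `X + Q(X)`.
      .X * (Pc + Pb + .X).comp (.X + Q), fun c => ?_⟩ hinit))
  set X := treeSize (c, l c, s c) with hX
  simp only [treeSize_pair] at hX
  obtain ⟨t, ht, hle⟩ := loop c (X + Q.eval X) (l c) (s c) fun l₁ l₂ h => by
    have h1 := hQ c l₁ l₂ h
    have h2 := treeSize_append_right l₁ l₂
    have h3 := Q.eval_le_eval_of_le (show treeSize c ≤ X by lia)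
    rw [← h] at h2
    simp only [treeSize_pair]
    lia
  refine ⟨t, ht, hle.trans ?_⟩
  simp only [Polynomial.eval_mul, Polynomial.eval_add, Polynomial.eval_comp, Polynomial.eval_X]
  refine Nat.mul_le_mul ?_ le_rfl
  have := length_lt_treeSize (l c)
  change _ ≤ X
  lia

theorem reverse {l : γ → List α} (hl : PolyTime l) : PolyTime fun c => (l c).reverse := by
  obtain ⟨P, hP⟩ := hl.exists_treeSize_le
  have key (l : List α) : l.foldl (fun s a => a :: s) [] = l.reverse := by
    rw [← List.foldr_reverse]
    exact List.foldr_cons_nil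
  have := foldl (s := fun _ => ([] : List α)) (g := fun _ s a => a :: s) hl (const [])
    (PolyTime.id.snd.fst.cons PolyTime.id.snd.snd) P fun c l₁ l₂ h => by
      rw [key, treeSize_reverse]
      exact (treeSize_append_left l₁ l₂).trans (h ▸ hP c)
  simpa only [key] using this

theorem foldr {l : γ → List α} {s : γ → σ} {g : γ → α → σ → σ} (hl : PolyTime l)
    (hs : PolyTime s) (hg : PolyTime fun x : γ × α × σ => g x.1 x.2.1 x.2.2) (Q : Polynomial ℕ)
    (hQ : ∀ c l₁ l₂, l c = l₁ ++ l₂ → treeSize (l₂.foldr (g c) (s c)) ≤ Q.eval (treeSize c)) :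
    PolyTime fun c => (l c).foldr (g c) (s c) := by
  have := foldl (g := fun c s a => g c a s) hl.reverse hs hg Q fun c l₁ l₂ h => by
    rw [← List.reverse_reverse l₁, List.foldl_reverse]
    exact hQ c l₂.reverse l₁.reverse (by rw [← List.reverse_append, ← h, List.reverse_reverse])
  simpa only [List.foldl_reverse] using this

theorem any {l : γ → List α} {p : γ → α → Bool} (hl : PolyTime l)
    (hp : PolyTime fun x : γ × α => p x.1 x.2) : PolyTime fun c => (l c).any (p c) := by
  have := foldr (g := fun c a b => p c a || b) hl (const false)
    (((hp.comp₂ PolyTime.id.fst PolyTime.id.snd.fst)).or PolyTime.id.snd.snd) (.C 2)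
    fun c l₁ l₂ h => by simpa using treeSize_bool_le _
  convert this using 2 with c
  induction l c <;> simp_all

theorem filter {l : γ → List α} {p : γ → α → Bool} (hl : PolyTime l)
    (hp : PolyTime fun x : γ × α => p x.1 x.2) : PolyTime fun c => (l c).filter (p c) := by
  have key (c : γ) (l : List α) :
      l.foldr (fun a s => bif p c a then a :: s else s) [] = l.filter (p c) := by
    induction l with
    | nil => rfl
    | cons a l ih => rw [List.foldr_cons, ih, List.filter_cons]; cases p c a <;> rfl
  obtain ⟨P, hP⟩ := hl.exists_treeSize_le
  have := foldr (s := fun _ => []) (g := fun c a s => bif p c a then a :: s else s) hl (const [])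
    ((hp.comp₂ PolyTime.id.fst PolyTime.id.snd.fst).cond
      (PolyTime.id.snd.fst.cons PolyTime.id.snd.snd) PolyTime.id.snd.snd) P fun c l₁ l₂ h => by
      rw [key]
      exact (treeSize_of_sublist List.filter_sublist).trans
        ((treeSize_append_right l₁ l₂).trans (h ▸ hP c))
  simpa only [key] using this

theorem map {l : γ → List α} {f : γ → α → β} (hl : PolyTime l)
    (hf : PolyTime fun x : γ × α => f x.1 x.2) : PolyTime fun c => (l c).map (f c) := by
  obtain ⟨P, hP⟩ := hl.exists_treeSize_le
  obtain ⟨R, hR⟩ := hf.exists_treeSize_le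
  have := foldr (s := fun _ => []) (g := fun c a s => f c a :: s) hl (const [])
    ((hf.comp₂ PolyTime.id.fst PolyTime.id.snd.fst).cons PolyTime.id.snd.snd)
    (P * R.comp (.X + P) + 1) fun c l₁ l₂ h => by
      rw [← List.map_eq_foldr]
      have h1 := hP c
      have h2 := (treeSize_append_right l₁ l₂).trans (h ▸ h1)
      refine (treeSize_list_le (b := R.eval (treeSize c + P.eval (treeSize c))) ?_).trans ?_
      · simp only [List.mem_map]
        rintro _ ⟨a, ha, rfl⟩
        refine (hR (c, a)).trans (R.eval_le_eval_of_le ?_)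
        rw [treeSize_pair]
        have := treeSize_le_of_mem ha
        lia
      · have := length_lt_treeSize l₂
        simp only [List.length_map, Polynomial.eval_add, Polynomial.eval_mul,
          Polynomial.eval_comp, Polynomial.eval_X, Polynomial.eval_one]
        gcongr
        lia
  simpa only [← List.map_eq_foldr] using this

theorem append {l l' : γ → List α} (hl : PolyTime l) (hl' : PolyTime l') :
    PolyTime fun c => l c ++ l' c := by
  obtain ⟨P, hP⟩ := hl.exists_treeSize_le
  obtain ⟨P', hP'⟩ := hl'.exists_treeSize_le
  have key (l l' : List α) : l.foldr (fun a s => a :: s) l' = l ++ l' := by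
    induction l with
    | nil => rfl
    | cons a l ih => rw [List.foldr_cons, ih, List.cons_append]
  have := foldr (g := fun c a s => a :: s) hl hl'
    (PolyTime.id.snd.fst.cons PolyTime.id.snd.snd) (P + P') fun c l₁ l₂ h => by
      have h1 := hP c
      have h2 := (treeSize_append_right l₁ l₂).trans (h ▸ h1)
      have h3 := hP' c
      rw [key]
      simp only [treeSize_list, List.map_append, List.sum_append, Polynomial.eval_add] at *
      lia
  simpa only [key] using this

theorem flatten {l : γ → List (List α)} (hl : PolyTime l) : PolyTime fun c => (l c).flatten := by
  obtain ⟨P, hP⟩ := hl.exists_treeSize_le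
  have key (l : List (List α)) : l.foldr (fun a s => a ++ s) [] = l.flatten := by
    induction l with
    | nil => rfl
    | cons a l ih => rw [List.foldr_cons, ih, List.flatten_cons]
  have size_le (l : List (List α)) : treeSize l.flatten ≤ treeSize l := by
    induction l with
    | nil => exact le_rfl
    | cons a l ih =>
      rw [treeSize_cons, List.flatten_cons]
      simp only [treeSize_list _ (α := α), List.map_append, List.sum_append] at *
      lia
  have := foldr (s := fun _ => []) (g := fun c a s => a ++ s) hl (const [])
    (PolyTime.id.snd.fst.append PolyTime.id.snd.snd) P fun c l₁ l₂ h => by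
      rw [key]
      exact (size_le _).trans ((treeSize_append_right l₁ l₂).trans (h ▸ hP c))
  simpa only [key] using this

theorem flatMap {l : γ → List α} {f : γ → α → List β} (hl : PolyTime l)
    (hf : PolyTime fun x : γ × α => f x.1 x.2) : PolyTime fun c => (l c).flatMap (f c) :=
  (hl.map hf).flatten

theorem length {l : γ → List α} (hl : PolyTime l) : PolyTime fun c => (l c).length := by
  obtain ⟨P, hP⟩ := hl.exists_treeSize_le
  have key (l : List α) : l.foldr (fun _ s => s + 1) 0 = l.length := by
    induction l with
    | nil => rfl
    | cons a l ih => rw [List.foldr_cons, ih, List.length_cons]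
  have := foldr (s := fun _ => 0) (g := fun _ _ s => s + 1) hl (const 0)
    PolyTime.id.snd.snd.succ P fun c l₁ l₂ h => by
      rw [key, treeSize_nat]
      exact (length_lt_treeSize l₂).trans_le ((treeSize_append_right l₁ l₂).trans (h ▸ hP c))
  simpa only [key] using this

theorem idxOf [DecidableEq α] {x : γ → α} {l : γ → List α} (hx : PolyTime x) (hl : PolyTime l) :
    PolyTime fun c => (l c).idxOf (x c) := by
  obtain ⟨P, hP⟩ := hl.exists_treeSize_le
  have key (c : γ) (l : List α) :
      l.foldr (fun a s => bif decide (a = x c) then 0 else s + 1) 0 = l.idxOf (x c) := by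
    induction l with
    | nil => rfl
    | cons a l ih =>
      rw [List.foldr_cons, ih, List.idxOf_cons]
      by_cases h : a = x c
      · simp [h]
      · rw [decide_eq_false h, beq_false_of_ne h]
  have := foldr (s := fun _ => 0) (g := fun c a s => bif decide (a = x c) then 0 else s + 1) hl
    (const 0) ((eq PolyTime.id.snd.fst (hx.comp PolyTime.id.fst)).cond (const 0)
      PolyTime.id.snd.snd.succ) P fun c l₁ l₂ h => by
      rw [key, treeSize_nat]
      exact (Nat.succ_le_succ List.idxOf_le_length).trans
        ((length_lt_treeSize l₂).trans_le ((treeSize_append_right l₁ l₂).trans (h ▸ hP c)))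
  simpa only [key] using this

theorem replicate_unit {n : γ → ℕ} (hn : PolyTime n) :
    PolyTime fun c => List.replicate (n c) () := by
  unfold PolyTime
  simp only [tree_replicate_unit]
  exact hn

theorem add {f g : γ → ℕ} (hf : PolyTime f) (hg : PolyTime g) : PolyTime fun c => f c + g c := by
  simpa using (hf.replicate_unit.append hg.replicate_unit).length

theorem iterate {n : γ → ℕ} {s : γ → σ} {g : γ → σ → σ} (hn : PolyTime n) (hs : PolyTime s)
    (hg : PolyTime fun x : γ × σ => g x.1 x.2) (Q : Polynomial ℕ)
    (hQ : ∀ c k, k ≤ n c → treeSize ((g c)^[k] (s c)) ≤ Q.eval (treeSize c)) :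
    PolyTime fun c => (g c)^[n c] (s c) := by
  have key (c : γ) (l : List Unit) : l.foldr (fun _ s => g c s) (s c) = (g c)^[l.length] (s c) := by
    induction l with
    | nil => rfl
    | cons a l ih => rw [List.foldr_cons, ih, List.length_cons, Function.iterate_succ_apply']
  have := foldr (g := fun c _ s => g c s) hn.replicate_unit hs
    (hg.comp₂ PolyTime.id.fst PolyTime.id.snd.snd) Q fun c l₁ l₂ h => by
      rw [key]
      refine hQ c _ ?_
      have := congrArg List.length h
      simp only [List.length_replicate, List.length_append] at this
      lia
  simpa only [key, List.length_replicate] using this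

/-- Iterating the predecessor gives truncated subtraction, and `f c < g c` means that `g c - f c` is
not 0. -/
theorem lt {f g : γ → ℕ} (hf : PolyTime f) (hg : PolyTime g) :
    PolyTime fun c => decide (f c < g c) := by
  obtain ⟨P, hP⟩ := hg.exists_treeSize_le
  have key (k n : ℕ) : (fun n => n - 1)^[k] n = n - k := by
    induction k with
    | zero => rfl
    | succ k ih => rw [Function.iterate_succ_apply', ih]; lia
  have hsub := iterate (g := fun _ s => s - 1) hf hg PolyTime.id.snd.pred P fun c k _ => by
    have := hP c
    rw [key]
    rw [treeSize_nat] at *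
    lia
  simp only [key] at hsub
  convert (eq hsub (const 0)).not using 2 with c
  rw [← decide_not]
  exact decide_eq_decide.2 (by lia)

/-- Repeatedly prepending the length of the list produces the range in reverse order. -/
theorem range {n : γ → ℕ} (hn : PolyTime n) : PolyTime fun c => List.range (n c) := by
  obtain ⟨P, hP⟩ := hn.exists_treeSize_le
  have key (k : ℕ) : (fun s : List ℕ => s.length :: s)^[k] [] = (List.range k).reverse := by
    induction k with
    | zero => rfl
    | succ k ih =>
      rw [Function.iterate_succ_apply', ih, List.range_succ, List.reverse_append]
      simp
  have := (iterate (g := fun _ (s : List ℕ) => s.length :: s) hn (const [])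
    (PolyTime.id.snd.length.cons PolyTime.id.snd) (P * P + 1) fun c k hk => by
      have h1 := hP c
      rw [treeSize_nat] at h1
      rw [key, treeSize_reverse]
      refine (treeSize_list_le (b := k) fun x hx => ?_).trans ?_
      · have := List.mem_range.1 hx
        rw [treeSize_nat]
        lia
      · simp only [List.length_range, Polynomial.eval_add, Polynomial.eval_mul,
          Polynomial.eval_one]
        gcongr <;> lia).reverse
  simpa only [key, List.reverse_reverse] using this

end PolyTime

/-! ### A program for the popular feasible edge problem -/

section GaleShapleyPolyTime

variable {γ ε : Type*} [TreeCode γ] [TreeCode ε] {mb wb : γ → ε → ε → Bool}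

theorem polyTime_isProposed (hmb : PolyTime fun x : γ × ε × ε => mb x.1 x.2.1 x.2.2)
    {R : γ → List ε} {f : γ → ε} (hR : PolyTime R) (hf : PolyTime f) :
    PolyTime fun c => isProposed (mb c) (R c) (f c) :=
  (hR.any (p := fun c g => mb c g (f c)) (hmb.comp (PolyTime.id.fst.pair
    (PolyTime.id.snd.pair (hf.comp PolyTime.id.fst))))).not

theorem polyTime_isRejected (hmb : PolyTime fun x : γ × ε × ε => mb x.1 x.2.1 x.2.2)
    (hwb : PolyTime fun x : γ × ε × ε => wb x.1 x.2.1 x.2.2)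
    {R : γ → List ε} {g : γ → ε} (hR : PolyTime R) (hg : PolyTime g) :
    PolyTime fun c => isRejected (mb c) (wb c) (R c) (g c) :=
  hR.any (p := fun c f => wb c f (g c) && isProposed (mb c) (R c) f)
    ((hwb.comp (PolyTime.id.fst.pair (PolyTime.id.snd.pair (hg.comp PolyTime.id.fst)))).and
      (polyTime_isProposed (γ := γ × ε) (mb := fun x => mb x.1)
        (hmb.comp (PolyTime.id.fst.fst.pair PolyTime.id.snd)) (hR.comp PolyTime.id.fst)
        PolyTime.id.snd))

theorem polyTime_galeShapleyStep (hmb : PolyTime fun x : γ × ε × ε => mb x.1 x.2.1 x.2.2)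
    (hwb : PolyTime fun x : γ × ε × ε => wb x.1 x.2.1 x.2.2) :
    PolyTime fun x : γ × List ε => galeShapleyStep (mb x.1) (wb x.1) x.2 :=
  PolyTime.id.snd.filter (p := fun (x : γ × List ε) g => !isRejected (mb x.1) (wb x.1) x.2 g)
    (polyTime_isRejected (γ := (γ × List ε) × ε) (mb := fun x => mb x.1.1)
      (wb := fun x => wb x.1.1) (hmb.comp (PolyTime.id.fst.fst.fst.pair PolyTime.id.snd))
      (hwb.comp (PolyTime.id.fst.fst.fst.pair PolyTime.id.snd)) PolyTime.id.fst.snd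
      PolyTime.id.snd).not

/-- Rounds only delete edges, so every intermediate list is bounded by the initial one. -/
theorem polyTime_galeShapley (hmb : PolyTime fun x : γ × ε × ε => mb x.1 x.2.1 x.2.2)
    (hwb : PolyTime fun x : γ × ε × ε => wb x.1 x.2.1 x.2.2) {L : γ → List ε}
    (hL : PolyTime L) : PolyTime fun c => galeShapley (mb c) (wb c) (L c) := by
  obtain ⟨P, hP⟩ := hL.exists_treeSize_le
  refine PolyTime.iterate (g := fun c => galeShapleyStep (mb c) (wb c)) hL.length hL
    (polyTime_galeShapleyStep hmb hwb) P fun c k _ => ?_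
  exact iterate_invariant (p := fun R => treeSize R ≤ P.eval (treeSize c))
    (fun R h => (treeSize_of_sublist List.filter_sublist).trans h) k _ (hP c)

end GaleShapleyPolyTime

/-- The inputs of the popular feasible edge problem: the edge, the men with their names, their
criticality and their lists, and the women with their names and their lists. -/
abbrev EdgeProblem := (ℕ × ℕ) × List (ℕ × Bool × List ℕ) × List (ℕ × List ℕ)

namespace EdgeProblem

/-- The number of levels for a critical man. -/
def numLevels (x : EdgeProblem) : ℕ := x.2.1.length + x.2.2.length + 2

/-- The man of `f` and `g` prefers `f`. -/
def manBetter (x : EdgeProblem) (f g : ℕ × ℕ × ℕ) : Bool :=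
  decide (f.1 = g.1) && (decide (f.2.2 < g.2.2) || (decide (f.2.2 = g.2.2) &&
    x.2.1.any fun r => decide (r.1 = f.1) &&
      decide (r.2.2.idxOf f.2.1 < r.2.2.idxOf g.2.1)))

/-- The woman of `f` and `g` prefers `f`. -/
def womanBetter (x : EdgeProblem) (f g : ℕ × ℕ × ℕ) : Bool :=
  decide (f.2.1 = g.2.1) && (decide (g.2.2 < f.2.2) || (decide (f.2.2 = g.2.2) &&
    x.2.2.any fun r => decide (r.1 = f.2.1) &&
      decide (r.2.idxOf f.1 < r.2.idxOf g.1)))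

/-- The levelled edges. -/
def edges (x : EdgeProblem) (c : ℕ) : List (ℕ × ℕ × ℕ) :=
  x.2.1.flatMap fun r => r.2.2.flatMap fun b =>
    (bif r.2.1 then List.range x.numLevels else List.range (c + 1)).map fun i => (r.1, b, i)

/-- The edges that survive the Gale-Shapley algorithm for the given edge at level `i`. -/
def survivors (x : EdgeProblem) (c i : ℕ) : List (ℕ × ℕ × ℕ) :=
  galeShapley x.manBetter x.womanBetter
    ((x.edges c).filter fun f => !x.womanBetter (x.1.1, x.1.2, i) f)

/-- The given edge is matched at level `i`, and all critical men are matched. -/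
def accepts (x : EdgeProblem) (c i : ℕ) : Bool :=
  ((x.survivors c i).any fun f => decide (f = (x.1.1, x.1.2, i))) &&
    isProposed x.manBetter (x.survivors c i) (x.1.1, x.1.2, i) &&
    !x.2.1.any fun r => r.2.1 && !(x.survivors c i).any fun f => decide (f.1 = r.1)

/-- The algorithm for the popular feasible edge problem. -/
def solve (x : EdgeProblem) : Bool :=
  (List.range 2).any fun c => (List.range x.numLevels).any fun i => x.accepts c i

theorem polyTime_numLevels : PolyTime numLevels :=
  (PolyTime.id.snd.fst.length.add PolyTime.id.snd.snd.length).succ.succ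

theorem polyTime_manBetter :
    PolyTime fun x : EdgeProblem × (ℕ × ℕ × ℕ) × (ℕ × ℕ × ℕ) => x.1.manBetter x.2.1 x.2.2 := by
  refine (PolyTime.eq PolyTime.id.snd.fst.fst PolyTime.id.snd.snd.fst).and
    ((PolyTime.lt PolyTime.id.snd.fst.snd.snd PolyTime.id.snd.snd.snd.snd).or
      ((PolyTime.eq PolyTime.id.snd.fst.snd.snd PolyTime.id.snd.snd.snd.snd).and
        (PolyTime.id.fst.snd.fst.any (p := fun
          (x : EdgeProblem × (ℕ × ℕ × ℕ) × (ℕ × ℕ × ℕ)) r => decide (r.1 = x.2.1.1) &&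
          decide (r.2.2.idxOf x.2.1.2.1 < r.2.2.idxOf x.2.2.2.1)) ?_)))
  exact (PolyTime.eq PolyTime.id.snd.fst PolyTime.id.fst.snd.fst.fst).and
    ((PolyTime.id.fst.snd.fst.snd.fst.idxOf PolyTime.id.snd.snd.snd).lt
      (PolyTime.id.fst.snd.snd.snd.fst.idxOf PolyTime.id.snd.snd.snd))

theorem polyTime_womanBetter :
    PolyTime fun x : EdgeProblem × (ℕ × ℕ × ℕ) × (ℕ × ℕ × ℕ) => x.1.womanBetter x.2.1 x.2.2 := by
  refine (PolyTime.eq PolyTime.id.snd.fst.snd.fst PolyTime.id.snd.snd.snd.fst).and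
    ((PolyTime.lt PolyTime.id.snd.snd.snd.snd PolyTime.id.snd.fst.snd.snd).or
      ((PolyTime.eq PolyTime.id.snd.fst.snd.snd PolyTime.id.snd.snd.snd.snd).and
        (PolyTime.id.fst.snd.snd.any (p := fun
          (x : EdgeProblem × (ℕ × ℕ × ℕ) × (ℕ × ℕ × ℕ)) r => decide (r.1 = x.2.1.2.1) &&
          decide (r.2.idxOf x.2.1.1 < r.2.idxOf x.2.2.1)) ?_)))
  exact (PolyTime.eq PolyTime.id.snd.fst PolyTime.id.fst.snd.fst.snd.fst).and
    ((PolyTime.id.fst.snd.fst.fst.idxOf PolyTime.id.snd.snd).lt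
      (PolyTime.id.fst.snd.snd.fst.idxOf PolyTime.id.snd.snd))

theorem polyTime_edges : PolyTime fun x : EdgeProblem × ℕ => x.1.edges x.2 := by
  refine PolyTime.id.fst.snd.fst.flatMap (f := fun (x : EdgeProblem × ℕ) r => r.2.2.flatMap fun b =>
    (bif r.2.1 then List.range x.1.numLevels else List.range (x.2 + 1)).map
      fun i => (r.1, b, i)) ?_
  refine PolyTime.id.snd.snd.snd.flatMap
    (f := fun (x : (EdgeProblem × ℕ) × (ℕ × Bool × List ℕ)) b =>
      (bif x.2.2.1 then List.range x.1.1.numLevels else List.range (x.1.2 + 1)).map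
        fun i => (x.2.1, b, i)) ?_
  refine PolyTime.map (f := fun (x : ((EdgeProblem × ℕ) × (ℕ × Bool × List ℕ)) × ℕ) i =>
    (x.1.2.1, x.2, i)) (PolyTime.id.fst.snd.snd.fst.cond
      (polyTime_numLevels.comp PolyTime.id.fst.fst.fst).range PolyTime.id.fst.fst.snd.succ.range) ?_
  exact PolyTime.id.fst.fst.snd.fst.pair (PolyTime.id.fst.snd.pair PolyTime.id.snd)

theorem polyTime_edge : PolyTime fun x : EdgeProblem × ℕ × ℕ => (x.1.1.1, x.1.1.2, x.2.2) :=
  PolyTime.id.fst.fst.fst.pair (PolyTime.id.fst.fst.snd.pair PolyTime.id.snd.snd)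

theorem polyTime_survivors :
    PolyTime fun x : EdgeProblem × ℕ × ℕ => x.1.survivors x.2.1 x.2.2 := by
  have hm : PolyTime fun x : (EdgeProblem × ℕ × ℕ) × (ℕ × ℕ × ℕ) × (ℕ × ℕ × ℕ) =>
      x.1.1.manBetter x.2.1 x.2.2 :=
    polyTime_manBetter.comp (PolyTime.id.fst.fst.pair PolyTime.id.snd)
  have hw : PolyTime fun x : (EdgeProblem × ℕ × ℕ) × (ℕ × ℕ × ℕ) × (ℕ × ℕ × ℕ) =>
      x.1.1.womanBetter x.2.1 x.2.2 :=
    polyTime_womanBetter.comp (PolyTime.id.fst.fst.pair PolyTime.id.snd)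
  have he : PolyTime fun x : EdgeProblem × ℕ × ℕ => x.1.edges x.2.1 :=
    polyTime_edges.comp (γ := EdgeProblem × ℕ × ℕ) (f := fun x => (x.1, x.2.1))
      (PolyTime.id.fst.pair PolyTime.id.snd.fst)
  have hb : PolyTime fun x : (EdgeProblem × ℕ × ℕ) × (ℕ × ℕ × ℕ) =>
      x.1.1.womanBetter (x.1.1.1.1, x.1.1.1.2, x.1.2.2) x.2 :=
    hw.comp (PolyTime.id.fst.pair ((polyTime_edge.comp PolyTime.id.fst).pair PolyTime.id.snd))
  have hL := he.filter (p := fun x f =>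
    !x.1.womanBetter (x.1.1.1, x.1.1.2, x.2.2) f) hb.not
  have := polyTime_galeShapley (mb := fun x : EdgeProblem × ℕ × ℕ => x.1.manBetter)
    (wb := fun x : EdgeProblem × ℕ × ℕ => x.1.womanBetter) hm hw hL
  exact this

theorem polyTime_accepts :
    PolyTime fun x : EdgeProblem × ℕ × ℕ => x.1.accepts x.2.1 x.2.2 := by
  have hm : PolyTime fun x : (EdgeProblem × ℕ × ℕ) × (ℕ × ℕ × ℕ) × (ℕ × ℕ × ℕ) =>
      x.1.1.manBetter x.2.1 x.2.2 :=
    polyTime_manBetter.comp (PolyTime.id.fst.fst.pair PolyTime.id.snd)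
  have h1 : PolyTime fun x : EdgeProblem × ℕ × ℕ =>
      (x.1.survivors x.2.1 x.2.2).any fun f => decide (f = (x.1.1.1, x.1.1.2, x.2.2)) :=
    polyTime_survivors.any (PolyTime.eq PolyTime.id.snd (polyTime_edge.comp PolyTime.id.fst))
  have h2 : PolyTime fun x : EdgeProblem × ℕ × ℕ =>
      isProposed x.1.manBetter (x.1.survivors x.2.1 x.2.2) (x.1.1.1, x.1.1.2, x.2.2) :=
    polyTime_isProposed hm polyTime_survivors polyTime_edge
  have h3 : PolyTime fun x : (EdgeProblem × ℕ × ℕ) × (ℕ × Bool × List ℕ) =>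
      (x.1.1.survivors x.1.2.1 x.1.2.2).any fun f => decide (f.1 = x.2.1) :=
    (polyTime_survivors.comp PolyTime.id.fst).any
      (PolyTime.eq PolyTime.id.snd.fst PolyTime.id.fst.snd.fst)
  exact (h1.and h2).and (PolyTime.id.fst.snd.fst.any (PolyTime.id.snd.snd.fst.and h3.not)).not

theorem polyTime_solve : PolyTime solve := by
  have h1 : PolyTime fun x : (EdgeProblem × ℕ) × ℕ => x.1.1.accepts x.1.2 x.2 :=
    polyTime_accepts.comp (γ := (EdgeProblem × ℕ) × ℕ) (f := fun x => (x.1.1, x.1.2, x.2))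
      (PolyTime.id.fst.fst.pair (PolyTime.id.fst.snd.pair PolyTime.id.snd))
  have h2 : PolyTime fun x : EdgeProblem × ℕ =>
      (List.range x.1.numLevels).any fun i => x.1.accepts x.2 i :=
    (polyTime_numLevels.comp (γ := EdgeProblem × ℕ) (f := fun x => x.1) PolyTime.id.fst).range.any
      (p := fun (x : EdgeProblem × ℕ) i => x.1.accepts x.2 i) h1
  exact (PolyTime.const (List.range 2)).any
    (p := fun (x : EdgeProblem) c => (List.range x.numLevels).any fun i => x.accepts c i) h2

end EdgeProblem

/-! ### Correctness of the program -/

theorem idxOf_map_val {k : ℕ} (l : List (Fin k)) (x : Fin k) :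
    (l.map Fin.val).idxOf x.val = l.idxOf x := by
  induction l with
  | nil => rfl
  | cons a l ih =>
    rw [List.map_cons, List.idxOf_cons, List.idxOf_cons, ih]
    by_cases h : a = x
    · simp [h]
    · rw [beq_false_of_ne h, beq_false_of_ne (Fin.val_ne_of_ne h)]

section GaleShapleyMap

variable {ε ε' : Type*} {v : ε → ε'} {mb wb : ε → ε → Bool} {mb' wb' : ε' → ε' → Bool}

theorem isProposed_map (hm : ∀ f g, mb' (v f) (v g) = mb f g) (R : List ε) (f : ε) :
    isProposed mb' (R.map v) (v f) = isProposed mb R f := by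
  simp only [isProposed, List.any_map, Function.comp_def, hm]

/-- The algorithm only looks at comparisons, so it commutes with any renaming that preserves them.
This transfers the results on vertices to the numbers that the program handles. -/
theorem galeShapley_map (hm : ∀ f g, mb' (v f) (v g) = mb f g)
    (hw : ∀ f g, wb' (v f) (v g) = wb f g) (L : List ε) :
    galeShapley mb' wb' (L.map v) = (galeShapley mb wb L).map v := by
  have hstep : Function.Semiconj (List.map v) (galeShapleyStep mb wb)
      (galeShapleyStep mb' wb') := fun R => by
    simp only [galeShapleyStep, isRejected, List.filter_map, List.any_map, Function.comp_def,
      isProposed_map hm, hw]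
  rw [galeShapley, galeShapley, List.length_map]
  exact ((hstep.iterate_right _).eq L).symm

end GaleShapleyMap

namespace MarriageInstance

variable {n m : ℕ} (I : MarriageInstance (Fin n) (Fin m)) (C : Finset (Fin n))
  (e : Fin n × Fin m)

/-- The data that are encoded as the input of the program. -/
def edgeProblem : EdgeProblem :=
  ((e.1.val, e.2.val), (List.finRange n).map (fun a => (a.val, decide (a ∈ C), (I.menPref a).map Fin.val)),
    (List.finRange m).map fun b => (b.val, (I.womenPref b).map Fin.val))

theorem tree_edgeProblem : tree (I.edgeProblem C e) = I.encode C e := by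
  -- A list of `Fin k` coerced to a list of numbers is a bind in the list monad; here it becomes a
  -- map.
  have h {k : ℕ} (l : List (Fin k)) : (do let a ← l; pure (a : ℕ)) = l.map Fin.val :=
    List.flatMap_pure_eq_map _ _
  simp only [tree, edgeProblem, encode, List.map_map, Function.comp_def, h]

/-- The numbers of the endpoints of a levelled edge. -/
def toNat (f : Fin n × Fin m × ℕ) : ℕ × ℕ × ℕ := (f.1, f.2.1, f.2.2)

theorem toNat_injective : Function.Injective (toNat (n := n) (m := m)) := by
  rintro ⟨a, b, i⟩ ⟨a', b', i'⟩ h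
  simp only [toNat, Prod.mk.injEq] at h
  rw [Fin.ext h.1, Fin.ext h.2.1, h.2.2]

theorem manBetter_toNat (f g : Fin n × Fin m × ℕ) :
    (I.edgeProblem C e).manBetter (toNat f) (toNat g) = I.manBetter f g := by
  rw [Bool.eq_iff_iff, manBetter_iff]
  simp only [EdgeProblem.manBetter, Bool.and_eq_true, Bool.or_eq_true, decide_eq_true_eq,
    List.any_eq_true]
  simp [toNat, edgeProblem, manRank, idxOf_map_val, Fin.val_inj]

theorem womanBetter_toNat (f g : Fin n × Fin m × ℕ) :
    (I.edgeProblem C e).womanBetter (toNat f) (toNat g) = I.womanBetter f g := by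
  rw [Bool.eq_iff_iff, womanBetter_iff]
  simp only [EdgeProblem.womanBetter, Bool.and_eq_true, Bool.or_eq_true, decide_eq_true_eq,
    List.any_eq_true]
  simp [toNat, edgeProblem, womanRank, idxOf_map_val, Fin.val_inj]

/-- The levelled edges as a list. -/
def edgeList (c : ℕ) : List (Fin n × Fin m × ℕ) :=
  (List.finRange n).flatMap fun a => (I.menPref a).flatMap fun b =>
    (bif decide (a ∈ C) then List.range (n + m + 2) else List.range (c + 1)).map
      fun i => (a, b, i)

theorem mem_edgeList (c : ℕ) :
    {f | f ∈ I.edgeList C c} = I.levelEdges (C : Set (Fin n)) c (n + m + 1) := by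
  ext ⟨a, b, i⟩
  by_cases h : a ∈ C
  · simp [edgeList, levelEdges, IsEdge, h]
    lia
  · simp [edgeList, levelEdges, IsEdge, h]

theorem edges_edgeProblem (c : ℕ) :
    (I.edgeProblem C e).edges c = (I.edgeList C c).map toNat := by
  simp [EdgeProblem.edges, EdgeProblem.numLevels, edgeProblem, edgeList, List.map_flatMap,
    List.flatMap_map, toNat, Function.comp_def]

/-- The edges that survive the Gale-Shapley algorithm for the edge `e` at level `i`. -/
def survivors (c i : ℕ) : List (Fin n × Fin m × ℕ) :=
  galeShapley I.manBetter I.womanBetter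
    ((I.edgeList C c).filter fun f => !I.womanBetter (e.1, e.2, i) f)

theorem survivors_edgeProblem (c i : ℕ) :
    (I.edgeProblem C e).survivors c i = (I.survivors C e c i).map toNat := by
  rw [survivors, ← galeShapley_map (I.manBetter_toNat C e) (I.womanBetter_toNat C e),
    EdgeProblem.survivors, edges_edgeProblem, List.filter_map]
  congr 2
  refine List.filter_congr fun f _ => ?_
  rw [← I.womanBetter_toNat C e]
  rfl

theorem accepts_edgeProblem_iff (c i : ℕ) :
    (I.edgeProblem C e).accepts c i ↔
      (e.1, e.2, i) ∈ galeShapleyMatching I.manBetter I.womanBetter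
        ((I.edgeList C c).filter fun f => !I.womanBetter (e.1, e.2, i) f) ∧
      ∀ a ∈ C, ∃ f ∈ I.survivors C e c i, f.1 = a := by
  have h : ((I.edgeProblem C e).1.1, (I.edgeProblem C e).1.2, i) = toNat (e.1, e.2, i) := rfl
  have h1 : ((I.survivors C e c i).map toNat).any (fun f => decide (f = toNat (e.1, e.2, i))) ↔
      (e.1, e.2, i) ∈ I.survivors C e c i := by
    simp only [List.any_map, List.any_eq_true, Function.comp_apply, decide_eq_true_eq,
      toNat_injective.eq_iff, exists_eq_right]
  have h2 : (!(I.edgeProblem C e).2.1.any fun r => r.2.1 &&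
      !((I.survivors C e c i).map toNat).any fun f => decide (f.1 = r.1)) = true ↔
      ∀ a ∈ C, ∃ f ∈ I.survivors C e c i, f.1 = a := by
    simp [edgeProblem, toNat, Fin.val_inj]
  rw [EdgeProblem.accepts, survivors_edgeProblem, h, isProposed_map (I.manBetter_toNat C e),
    Bool.and_eq_true, Bool.and_eq_true, h1, h2]
  rfl

/-- The check of the critical men makes acceptance sound. It never rejects wrongly: if a popular
feasible matching exists, then every stable matching of the multigraph is feasible. -/
theorem solve_edgeProblem_iff :
    (I.edgeProblem C e).solve ↔ ∃ M, I.IsPopularFeasible (C : Set (Fin n)) M ∧ e ∈ M := by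
  have hm := I.isStarOrder_manBetter
  have hw := I.isStarOrder_womanBetter
  have hE (c : ℕ) : ∀ f ∈ I.edgeList C c, I.IsEdge (f.1, f.2.1) := fun f hf =>
    ((I.mem_edgeList C c).subset hf).1
  have hsolve : (I.edgeProblem C e).solve ↔
      ∃ c ≤ 1, ∃ i ≤ n + m + 1, (I.edgeProblem C e).accepts c i := by
    simp only [EdgeProblem.solve, List.any_eq_true, List.mem_range]
    simp [EdgeProblem.numLevels, edgeProblem, Nat.lt_succ_iff]
  rw [hsolve]
  constructor
  · rintro ⟨c, hc, i, -, h⟩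
    obtain ⟨he, hcrit⟩ := (I.accepts_edgeProblem_iff C e c i).1 h
    have hS := isStableIn_of_mem_galeShapleyMatching hm hw (hE c) he
    rw [mem_edgeList] at hS
    have hfeas : I.IsFeasible (C : Set (Fin n)) (underlying (galeShapleyMatching I.manBetter
        I.womanBetter ((I.edgeList C c).filter fun f => !I.womanBetter (e.1, e.2, i) f))) := by
      refine ⟨IsLevelStable.isMatching hS, fun a ha => ?_⟩
      obtain ⟨f, hf, rfl⟩ := hcrit a ha
      -- A man with a surviving edge also has a proposed one, and that edge is in the matching.
      obtain ⟨⟨a, b, j⟩, hg, hgp, hgf⟩ := hm.exists_isProposed hf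
      have : a = f.1 := by
        rcases hgf with rfl | hgf
        · rfl
        · exact hm.same hgf
      exact ⟨b, mem_underlying.2 ⟨j, this ▸ ⟨hg, hgp⟩⟩⟩
    exact ⟨_, IsLevelStable.isPopularFeasible hS hc (by lia) hfeas, mem_underlying.2 ⟨i, he⟩⟩
  · rintro ⟨M, hM, he⟩
    -- `K = n + m + 1` is the bound that the certificates need; the program tries the `n + m + 2`
    -- levels from 0 to `K`.
    obtain ⟨c, hc, S, hS, i, hi⟩ := hM.exists_isLevelStable (K := n + m + 1) he (by simp)
    refine ⟨c, hc, i, ?_, ?_⟩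
    · have := hS.subset hi
      by_cases ha : e.1 ∈ C
      · exact this.2.1 ha
      · exact (this.2.2 ha).trans (by lia)
    rw [← mem_edgeList] at hS
    have he := hS.mem_galeShapleyMatching hm hw (hE c) hi
    refine (I.accepts_edgeProblem_iff C e c i).2 ⟨he, fun a ha => ?_⟩
    have hG := isStableIn_of_mem_galeShapleyMatching hm hw (hE c) he
    rw [mem_edgeList] at hG
    obtain ⟨b, hb⟩ := (IsLevelStable.isFeasible hG (by simp; lia) hM.1).2 a ha
    obtain ⟨j, hj⟩ := mem_underlying.1 hb
    exact ⟨_, hj.1, rfl⟩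

/-! ### Size of the input and conclusion -/

theorem length_menPref_le (a : Fin n) : (I.menPref a).length ≤ m := by
  simpa using (I.menPref_nodup a).length_le_card

theorem length_womenPref_le (b : Fin m) : (I.womenPref b).length ≤ n := by
  simpa using (I.womenPref_nodup b).length_le_card

/-- With `s` the size of the instance, a unary name has size at most `s` and a preference list size
at most `s ^ 2 + 1`. There are at most `s` lists on each side, so the encoding is cubic. -/
theorem size_encode_le :
    (I.encode C e).size ≤ 2 * I.size + 2 * (I.size * (I.size ^ 2 + I.size + 3) + 1) := by
  rw [← tree_edgeProblem]
  change treeSize (I.edgeProblem C e) ≤ _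
  have hn : n ≤ I.size := by unfold size; lia
  have hm : m ≤ I.size := by unfold size; lia
  generalize I.size = s at *
  have names {k : ℕ} (hk : k ≤ s) {l : List (Fin k)} (hl : l.length ≤ s) :
      treeSize (l.map Fin.val) ≤ s ^ 2 + 1 := by
    refine (treeSize_list_le (b := s) fun x hx => ?_).trans ?_
    · obtain ⟨b, -, rfl⟩ := List.mem_map.1 hx
      rw [treeSize_nat]
      lia
    · rw [List.length_map, pow_two]
      gcongr
  have hmen : treeSize (I.edgeProblem C e).2.1 ≤ s * (s ^ 2 + s + 3) + 1 := by
    refine (treeSize_list_le (b := s ^ 2 + s + 3) fun x hx => ?_).trans ?_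
    · obtain ⟨a, -, rfl⟩ := List.mem_map.1 hx
      have h1 := names hm ((I.length_menPref_le a).trans hm)
      have h2 := treeSize_bool_le (decide (a ∈ C))
      simp only [treeSize_pair, treeSize_nat]
      lia
    · simp only [edgeProblem, List.length_map, List.length_finRange]
      gcongr
  have hwomen : treeSize (I.edgeProblem C e).2.2 ≤ s * (s ^ 2 + s + 3) + 1 := by
    refine (treeSize_list_le (b := s ^ 2 + s + 3) fun x hx => ?_).trans ?_
    · obtain ⟨b, -, rfl⟩ := List.mem_map.1 hx
      have h1 := names hn ((I.length_womenPref_le b).trans hn)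
      simp only [treeSize_pair, treeSize_nat]
      lia
    · simp only [edgeProblem, List.length_map, List.length_finRange]
      gcongr
  have h : treeSize (I.edgeProblem C e) = (e.1 + 1) + (e.2 + 1) +
      (treeSize (I.edgeProblem C e).2.1 + treeSize (I.edgeProblem C e).2.2) := by
    rw [← treeSize_nat, ← treeSize_nat, ← treeSize_pair, ← treeSize_pair, ← treeSize_pair]
    rfl
  lia

end MarriageInstance

theorem exists_solvesPopularFeasibleEdge :
    ∃ (p : Code) (T : Polynomial ℕ), p.SolvesPopularFeasibleEdge fun s => T.eval s := by
  obtain ⟨p, P, hp⟩ := EdgeProblem.polyTime_solve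
  refine ⟨p, P.comp (2 * .X + 2 * (.X * (.X ^ 2 + .X + 3) + 1)), fun n m I C e _ => ?_⟩
  obtain ⟨t, ht, hle⟩ := hp (I.edgeProblem C e)
  simp only [I.tree_edgeProblem] at ht hle
  refine ⟨_, t, ht, hle.trans ?_, ?_⟩
  · simp only [Polynomial.eval_comp]
    refine P.eval_le_eval_of_le ((I.size_encode_le C e).trans_eq ?_)
    simp
  · rw [← I.solve_edgeProblem_iff C e]
    cases (I.edgeProblem C e).solve <;> simp [tree, Data.ofBool]

theorem theorem1 :
    (∀ (A B : Type*) [Fintype A] [Fintype B] [DecidableEq A] [DecidableEq B]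
      (I : MarriageInstance A B) (C : Set A) (e : A × B), I.IsEdge e →
      ((∃ M, I.IsPopularFeasible C M ∧ e ∈ M) ↔
        ((∃ M, I.IsMinSizePopularFeasible C M ∧ e ∈ M) ∨
          (∃ M, I.IsDominantFeasible C M ∧ e ∈ M)))) ∧
    (∃ (p : Code) (T : Polynomial ℕ), p.SolvesPopularFeasibleEdge fun s => T.eval s) :=
  ⟨fun _ _ _ _ _ _ _ C e _ => MarriageInstance.exists_isPopularFeasible_iff C e,
    exists_solvesPopularFeasibleEdge⟩
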